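/- Let $r,c\ge 1$ and $n=r+c$. Write $x\Vert z$ for the concatenation of $x\in\{0,1\}^r$ and $z\in\{0,1\}^c$, let $\oplus$ be bitwise XOR, and let $\pi$ be a permutation of $\{0,1\}^n$. Consider oracles $k,k':\{0,1\}^r\to\{0,1\}^c$ and $h:\{0,1\}^c\to\{0,1\}^r$. A database $D=(D_k,D_{k'},D_h)$ assigns to every input of $k$, $k'$, $h$ either an output of the corresponding length or $\bot$; write $x\in D_k$ if $D_k(x)\ne\bot$, and similarly for $D_{k'}$. The set $\mathsf{tail}^D(z)$ of tails of $z\in\{0,1\}^c$ is defined recursively: the empty string is a tail of $0^c$; and if $t$ is a tail of $z_p$, $x_p\in D_k$, $\pi(x_p\Vert (z_p\oplus D_k(x_p)))=x_i\Vert z_i$ and $x_i\in D_{k'}$, then $t\Vert x_p$ is a tail of $z_i\oplus D_{k'}(x_i)$. The set of intermediate pairs is $$\mathsf{IP}^D=\{(x,z): x\Vert z=\pi(x_p\Vert (z_p\oplus D_k(x_p)))\text{ for some }x_p\in D_k\text{ and some }z_p\text{ with }\mathsf{tail}^D(z_p)\neq\emptyset\}.$$ Let $\mathrm{BAD}=\mathrm{BAD}_\pi$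 be the set of databases $D$ such that $|\mathsf{tail}^D(z)|\ge 2$ for some $z\in\{0,1\}^c$, or there are $(x_1,z_1),(x_2,z_2)\in \mathsf{IP}^D$ with $x_1=x_2$ and $z_1\ne z_2$. A quantum query algorithm holds an input register $X$ (an input of one of $k,k',h$, possibly in superposition), an output register $Y$ (of the length that belongs to that input) and a workspace of arbitrary finite dimension. The oracle holds a register $F$ with orthonormal basis the databases, initially in the state $|\emptyset\rangle$ of the database with all entries $\bot$. A query applies $\mathsf{cO}=C\,\mathcal P\,C^\dagger$, where $\mathcal P|x\rangle|y\rangle|D\rangle=|x\rangle|y\oplus D(x)\rangle|D\rangle$ (with $y\oplus\bot=y$) and $C$ is the tensor product over all oracle inputs of the unitaries $I-|\bot\rangle\langle\bot|-|\mu\rangle\langle\mu|+|\bot\rangle\langle\mu|+|\mu\rangle\langle\bot|$, with $|\mu\rangle$ the uniform superposition of all outputs other than $\bot$. For a set $\mathsf Q$ of databases let $\Pi^{\mathsf Q}$ be the projector onto the span of the $|D\rangle$, $D\in \mathsf Q$, and let $$[\![\emptyset\xrightarrow{q}\mathsf Q]\!]=\sup_{U_1,\dots,U_{q-1}}\big\|\Pi^{\mathsf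 Q}\,\mathsf{cO}\,U_{q-1}\,\mathsf{cO}\cdots \mathsf{cO}\,U_1\,\mathsf{cO}\,\Pi^{\{\emptyset\}}\big\|,$$ where the supremum is over all workspace dimensions $d\ge1$ and all unitaries on the registers of the algorithm (for $q=0$ the norm is that of $\Pi^{\mathsf Q}\Pi^{\{\emptyset\}}$). Then there is an absolute constant $C_0>0$ such that for all $r,c\ge1$ the following holds. For every permutation $\pi$, every $q\ge0$ and every quantum query algorithm $\mathcal A$, the probability $p'$ that measuring the database after $q$ queries of $\mathcal A$ gives an element of $\mathrm{BAD}_\pi$ satisfies $$p'\le[\![\emptyset\xrightarrow{q}\mathrm{BAD}_\pi]\!]^2 .$$ Moreover, for all but a fraction of at most $2^{-n}$ of the permutations $\pi$ of $\{0,1\}^n$, for all $q\ge 0$, $$[\![\emptyset\xrightarrow{q}\mathrm{BAD}_\pi]\!]^2\le C_0\,q^5\,n\,2^{-\min(r,c)} .$$ -/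

import Mathlib

open scoped Kronecker

/-- Bit strings of length `m`; addition is bitwise XOR and `0` is the all-zero string. -/
abbrev Bits (m : ℕ) : Type := Fin m → ZMod 2

/-- Inputs to the three oracles: `inl (inl x)` is the input `x` of `k`, `inl (inr x)` the input `x`
of `k'`, and `inr z` the input `z` of `h`. -/
abbrev OracleInput (r c : ℕ) : Type := (Bits r ⊕ Bits r) ⊕ Bits c

/-- Output lengths: `k, k' : {0,1}^r → {0,1}^c` and `h : {0,1}^c → {0,1}^r`. -/
def outLen {r c : ℕ} : OracleInput r c → ℕ
  | .inl _ => c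
  | .inr _ => r

/-- Databases: partial functions with one entry for every oracle input; `none` is `⊥`. -/
abbrev Database (r c : ℕ) : Type := (i : OracleInput r c) → Option (Bits (outLen i))

/-- Basis of the query registers: an oracle input and an output of the length that belongs to
this input. -/
abbrev Query (r c : ℕ) : Type := (i : OracleInput r c) × Bits (outLen i)

instance (r c : ℕ) : DecidableEq (OracleInput r c) := inferInstance

instance (r c : ℕ) : DecidableEq (Query r c) := inferInstance

instance (r c : ℕ) : DecidableEq (Database r c) := inferInstance

instance (r c : ℕ) : Fintype (Query r c) := inferInstance

instance (r c : ℕ) : Fintype (Database r c) := inferInstance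

/-- The part of the database that belongs to `k`. -/
def Database.dbK {r c : ℕ} (D : Database r c) (x : Bits r) : Option (Bits c) := D (.inl (.inl x))

/-- The part of the database that belongs to `k'`. -/
def Database.dbK' {r c : ℕ} (D : Database r c) (x : Bits r) : Option (Bits c) := D (.inl (.inr x))

/-- The database without entries. -/
def emptyDatabase (r c : ℕ) : Database r c := fun _ => none

section Combinatorics

variable {r c : ℕ}

/-- `IsTail π D z l`: the list of blocks `l` is a tail of the capacity value `z`. A state
`x ∥ z` of `r + c` bits is written as the pair `(x, z)`. -/
inductive IsTail (π : Equiv.Perm (Bits r × Bits c)) (D : Database r c) :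
    Bits c → List (Bits r) → Prop
  | nil : IsTail π D 0 []
  | step {zp zi yp yi : Bits c} {xp xi : Bits r} {l : List (Bits r)}
      (hzp : IsTail π D zp l)
      (hxp : D.dbK xp = some yp)
      (hxi : D.dbK' xi = some yi)
      (hπ : (xi, zi) = π (xp, zp + yp)) :
      IsTail π D (zi + yi) (l ++ [xp])

/-- The set of tails of `z`. -/
def tails (π : Equiv.Perm (Bits r × Bits c)) (D : Database r c) (z : Bits c) :
    Set (List (Bits r)) :=
  {l | IsTail π D z l}

/-- The set of intermediate pairs. -/
def intermediatePairs (π : Equiv.Perm (Bits r × Bits c)) (D : Database r c) :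
    Set (Bits r × Bits c) :=
  {p | ∃ (xp : Bits r) (yp zp : Bits c),
    D.dbK xp = some yp ∧ (tails π D zp).Nonempty ∧ p = π (xp, zp + yp)}

/-- The predicate `BAD`: some capacity value has at least two tails, or two intermediate pairs
have the same first and different second component. -/
def BAD (π : Equiv.Perm (Bits r × Bits c)) : Set (Database r c) :=
  {D | (∃ z : Bits c, 2 ≤ (tails π D z).encard) ∨
    ∃ p₁ ∈ intermediatePairs π D, ∃ p₂ ∈ intermediatePairs π D, p₁.1 = p₂.1 ∧ p₁.2 ≠ p₂.2}

end Combinatorics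

noncomputable section Quantum

/-- The vector `|⊥⟩` of a single database entry. -/
def ketBot (m : ℕ) : Option (Bits m) → ℂ
  | none => 1
  | some _ => 0

/-- The vector `|μ⟩`, the uniform superposition of all values other than `⊥`. -/
def ketMu (m : ℕ) : Option (Bits m) → ℂ
  | none => 0
  | some _ => ((Real.sqrt (2 ^ m) : ℝ) : ℂ)⁻¹

/-- The compression of a single database entry,
`I - |⊥⟩⟨⊥| - |μ⟩⟨μ| + |⊥⟩⟨μ| + |μ⟩⟨⊥|`. -/
def entryCompression (m : ℕ) : Matrix (Option (Bits m)) (Option (Bits m)) ℂ :=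
  1 - Matrix.vecMulVec (ketBot m) (star (ketBot m)) - Matrix.vecMulVec (ketMu m) (star (ketMu m))
    + Matrix.vecMulVec (ketBot m) (star (ketMu m)) + Matrix.vecMulVec (ketMu m) (star (ketBot m))

/-- The compression of the whole database: the tensor product of the compressions of all
entries. -/
def compression (r c : ℕ) : Matrix (Database r c) (Database r c) ℂ :=
  Matrix.of fun D' D => ∏ i, entryCompression (outLen i) (D' i) (D i)

/-- Basis of the registers held by the algorithm: the query registers and a workspace of
dimension `d`. -/
abbrev AlgBasis (r c d : ℕ) : Type := Query r c × Fin d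

/-- Basis of the joint space of the algorithm and the database. -/
abbrev JointBasis (r c d : ℕ) : Type := AlgBasis r c d × Database r c

/-- The purified oracle on basis states, `|x⟩|y⟩|w⟩|D⟩ ↦ |x⟩|y ⊕ D(x)⟩|w⟩|D⟩`, where
`y ⊕ ⊥ = y`. -/
def purifiedStep {r c d : ℕ} : JointBasis r c d → JointBasis r c d
  | ((⟨i, y⟩, w), D) => ((⟨i, y + (D i).getD 0⟩, w), D)

/-- The purified oracle as an operator. -/
def purifiedOracle (r c d : ℕ) : Matrix (JointBasis r c d) (JointBasis r c d) ℂ :=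
  Matrix.of fun s' s => if s' = purifiedStep s then 1 else 0

/-- An operator of the algorithm, acting as the identity on the database. -/
def onAlg {r c d : ℕ} (U : Matrix (AlgBasis r c d) (AlgBasis r c d) ℂ) :
    Matrix (JointBasis r c d) (JointBasis r c d) ℂ :=
  U ⊗ₖ (1 : Matrix (Database r c) (Database r c) ℂ)

/-- An operator on the database, acting as the identity on the registers of the algorithm. -/
def onDatabase {r c : ℕ} (d : ℕ) (M : Matrix (Database r c) (Database r c) ℂ) :
    Matrix (JointBasis r c d) (JointBasis r c d) ℂ :=
  (1 : Matrix (AlgBasis r c d) (AlgBasis r c d) ℂ) ⊗ₖ M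

/-- A query to the compressed oracle: decompress, apply the purified oracle, compress. -/
def compressedOracle (r c d : ℕ) : Matrix (JointBasis r c d) (JointBasis r c d) ℂ :=
  onDatabase d (compression r c) * purifiedOracle r c d *
    (onDatabase d (compression r c)).conjTranspose

open Classical in
/-- The projector `Π^P` onto the databases in `P`. -/
def databaseProjector {r c : ℕ} (d : ℕ) (P : Set (Database r c)) :
    Matrix (JointBasis r c d) (JointBasis r c d) ℂ :=
  onDatabase d (Matrix.diagonal fun D => if D ∈ P then 1 else 0)

/-- `q` queries with the unitaries `U 1, …, U (q - 1)` in between,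
`cO U_{q-1} cO ⋯ cO U_1 cO`. -/
def queryChain {r c d : ℕ} (U : ℕ → Matrix.unitaryGroup (AlgBasis r c d) ℂ) :
    ℕ → Matrix (JointBasis r c d) (JointBasis r c d) ℂ
  | 0 => 1
  | 1 => compressedOracle r c d
  | t + 2 => compressedOracle r c d * onAlg (U (t + 1)).1 * queryChain U (t + 1)

/-- The quantum transition capacity for `q` sequential queries from the databases in `P` to the
databases in `Q`: the supremum, over all workspace dimensions and all unitaries between the
queries, of the operator norm of `Π^Q cO U_{q-1} cO ⋯ cO U_1 cO Π^P`. -/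
def transitionCapacity {r c : ℕ} (q : ℕ) (P Q : Set (Database r c)) : ℝ :=
  sSup {a : ℝ | ∃ d : ℕ, 0 < d ∧ ∃ U : ℕ → Matrix.unitaryGroup (AlgBasis r c d) ℂ,
    a = ‖Matrix.toEuclideanCLM (𝕜 := ℂ)
      (databaseProjector d Q * queryChain U q * databaseProjector d P)‖}

/-- A quantum query algorithm: a workspace dimension, an initial state, and the unitaries that it
applies before, between and after its queries. -/
structure QueryAlgorithm (r c : ℕ) where
  dim : ℕ
  init : EuclideanSpace ℂ (AlgBasis r c dim)
  norm_init : ‖init‖ = 1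
  U : ℕ → Matrix.unitaryGroup (AlgBasis r c dim) ℂ

/-- The joint state of the algorithm and the compressed oracle after `q` queries,
`U_q cO U_{q-1} ⋯ U_1 cO U_0 |init⟩|∅⟩`. -/
def QueryAlgorithm.state {r c : ℕ} (A : QueryAlgorithm r c) :
    ℕ → EuclideanSpace ℂ (JointBasis r c A.dim)
  | 0 => Matrix.toEuclideanCLM (𝕜 := ℂ) (onAlg (A.U 0).1)
      (WithLp.toLp 2 fun s => if s.2 = emptyDatabase r c then A.init s.1 else 0)
  | t + 1 => Matrix.toEuclideanCLM (𝕜 := ℂ)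
      (onAlg (A.U (t + 1)).1 * compressedOracle r c A.dim) (A.state t)

/-- The probability that the measurement of the database after `q` queries finds it in `P`. -/
def QueryAlgorithm.prob {r c : ℕ} (A : QueryAlgorithm r c) (q : ℕ) (P : Set (Database r c)) : ℝ :=
  ‖Matrix.toEuclideanCLM (𝕜 := ℂ) (databaseProjector A.dim P) (A.state q)‖ ^ 2

end Quantum

/-! ### Random permutations: concentration of the first components. -/

section RandomPermutations

open Finset

/-! The only randomness needed from the permutation is captured by `IsSpread M π`: first components
of `π` take no value too often on a coset of the capacity part, and agree rarely between two
different cosets or shifts. For a good database, a fresh value of `k` or `k'` can cause badness only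
through such a coincidence or, for `k'`, by hitting a reachable capacity value; values of `h` are
harmless. Goodness also limits the number of possible coincidences: each block carries at most one
intermediate pair, so a database with `m` entries has at most `m + 1` reachable values and at most
`(m + 1) ^ 2 - 1` occupied blocks. Thus fewer than `s` entries leave at most `3 * s ^ 3 * M` harmful
values out of `2 ^ c` (`card_update_mem_BAD_le`).

On the quantum side, a query acts on one entry at a time. If the harmful values of that entry have
density at most `γ` and carry no amplitude before the query, they have amplitude at most `6 * √γ`
times the original norm afterwards (`sum_norm_sq_entry_query_le`). The estimate holds in orthogonal
blocks, so there is no loss from superposed inputs, and contributions of successive queries add up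
by the triangle inequality (`transitionCapacity_le`). With `γ = 3 * q ^ 3 * M / 2 ^ c` the squared
norm is at most `108 * q ^ 5 * M / 2 ^ c`.

A random permutation is spread with `M` of order `(r + c) * 2 ^ (c - min r c)`: reveal its values
one by one, then take union bounds over sets of coincidences and over all conditions
(`card_not_isSpread_le`). The bound for an individual algorithm follows because its first and last
unitaries commute with the database projectors. -/

open Classical in
/-- If `B` and `P` depend only on the values of a permutation on `F`, then among the permutations
in `B` the value at a point `p ∉ F` satisfies `P` with probability at most `K / (N - |F|)`. -/
theorem card_perm_filter_mul_le {α : Type*} [Fintype α] [DecidableEq α] (F : Finset α)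
    (p : α) (hp : p ∉ F)
    (B : Equiv.Perm α → Prop) (P : Equiv.Perm α → α → Prop) (K : ℕ)
    (hB : ∀ π π' : Equiv.Perm α, (∀ a ∈ F, π a = π' a) → B π → B π')
    (hP : ∀ π π' : Equiv.Perm α, (∀ a ∈ F, π a = π' a) → ∀ v, P π v → P π' v)
    (hK : ∀ π, #{v | P π v} ≤ K) :
    #{π | B π ∧ P π (π p)} * (Fintype.card α - #F) ≤ #{π | B π} * K := by
  -- Double counting by rerouting: swapping `π p` with a value `v` not taken on `F` preserves
  -- everything seen on `F`. Each `π` has `N - |F|` such images; conversely `v = π' p`, so `π` is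
  -- recovered from `π'` and the old value `π p`, for which there are at most `K` choices.
  refine Finset.card_mul_le_card_mul
    (fun π π' : Equiv.Perm α => ∃ v, v ∉ F.image π ∧ π' = Equiv.swap (π p) v * π) ?_ ?_
  · intro π hπ
    rw [mem_filter] at hπ
    have hinj : Function.Injective (fun v => Equiv.swap (π p) v * π) := by
      intro v w hvw
      have := congrArg (fun σ : Equiv.Perm α => σ p) hvw
      simpa using this
    have hcard : Fintype.card α - #F =
        #((univ \ F.image π).image (fun v => Equiv.swap (π p) v * π)) := by
      rw [card_image_of_injective _ hinj, card_sdiff_of_subset (subset_univ _), card_univ,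
        card_image_of_injective _ π.injective]
    rw [hcard]
    refine card_le_card fun π' hπ' => ?_
    obtain ⟨v, hv, rfl⟩ := mem_image.1 hπ'
    have hv' : v ∉ F.image π := (mem_sdiff.1 hv).2
    rw [mem_bipartiteAbove, mem_filter]
    refine ⟨⟨mem_univ _, hB π _ (fun a ha => ?_) hπ.2.1⟩, v, hv', rfl⟩
    rw [Equiv.Perm.mul_apply, Equiv.swap_apply_of_ne_of_ne]
    · intro h
      exact hp (π.injective h ▸ ha)
    · rintro rfl
      exact hv' (mem_image_of_mem _ ha)
  · intro π' _
    refine le_trans (card_le_card (t := ((univ.filter fun v => P π' v).image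
      fun u => Equiv.swap u (π' p) * π')) ?_) (card_image_le.trans (hK π'))
    intro π hπ
    rw [mem_bipartiteBelow, mem_filter] at hπ
    obtain ⟨⟨-, -, hPπ⟩, v, hv, rfl⟩ := hπ
    refine mem_image.2 ⟨π p, mem_filter.2 ⟨mem_univ _, hP π _ (fun a ha => ?_) _ hPπ⟩, ?_⟩
    · rw [Equiv.Perm.mul_apply, Equiv.swap_apply_of_ne_of_ne]
      · intro h
        exact hp (π.injective h ▸ ha)
      · rintro rfl
        exact hv (mem_image_of_mem _ ha)
    · rw [← mul_assoc]
      simp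

open Classical in
/-- Joint probability bound for conditions on the values of a random permutation at the distinct
points `p z`, each condition depending on at most one further value. -/
theorem card_perm_forall_mul_pow_le {α Z : Type*} [Fintype α] [DecidableEq α]
    (p : Z → α) (F : Z → Finset α)
    (P : Z → Equiv.Perm α → α → Prop) (K h : ℕ) (hF : ∀ z, #(F z) ≤ 1)
    (hP : ∀ z, ∀ π π' : Equiv.Perm α, (∀ a ∈ F z, π a = π' a) → ∀ v, P z π v → P z π' v)
    (hK : ∀ z π, #{v | P z π v} ≤ K) (T : Finset Z) (hp : Set.InjOn p T)
    (hpF : ∀ z ∈ T, ∀ z' ∈ T, p z ∉ F z') (hT : 2 * #T + h ≤ Fintype.card α) :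
    #{π : Equiv.Perm α | ∀ z ∈ T, P z π (π (p z))} * h ^ #T ≤
      K ^ #T * Fintype.card (Equiv.Perm α) := by
  induction T using Finset.induction_on with
  | empty => simp [Finset.card_univ]
  | insert z T hz ih =>
    rw [card_insert_of_notMem hz] at hT ⊢
    have ih' := ih (hp.mono (by simp))
      (fun a ha b hb => hpF a (mem_insert_of_mem ha) b (mem_insert_of_mem hb)) (by omega)
    -- All points on which the earlier conditions and the new condition depend. At most two per
    -- element of `T` and one for `z`, so at least `h` values remain free at `p z`.
    set F' : Finset α := (T.biUnion fun z' => insert (p z') (F z')) ∪ F z with hF'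
    have hF'card : #F' ≤ 2 * #T + 1 := by
      refine (card_union_le _ _).trans (Nat.add_le_add ?_ (hF z))
      refine (card_biUnion_le_card_mul _ _ 2 fun z' _ => ?_).trans (by omega)
      exact (card_insert_le _ _).trans (by have := hF z'; omega)
    have hmem : ∀ z' ∈ T, p z' ∈ F' ∧ F z' ⊆ F' := fun z' hz' =>
      ⟨mem_union_left _ (mem_biUnion.2 ⟨z', hz', mem_insert_self _ _⟩),
        fun a ha => mem_union_left _ (mem_biUnion.2 ⟨z', hz', mem_insert_of_mem ha⟩)⟩
    have hpz : p z ∉ F' := by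
      rw [hF', mem_union, mem_biUnion]
      rintro (⟨z', hz', h'⟩ | h')
      · rcases mem_insert.1 h' with h' | h'
        · have := hp (mem_insert_self z T) (mem_insert_of_mem hz') h'
          exact hz (this ▸ hz')
        · exact hpF z (mem_insert_self _ _) z' (mem_insert_of_mem hz') h'
      · exact hpF z (mem_insert_self _ _) z (mem_insert_self _ _) h'
    have key := card_perm_filter_mul_le F' (p z) hpz
      (fun π => ∀ z ∈ T, P z π (π (p z))) (P z) K
      (fun π π' hag hπ z' hz' => by
        rw [← hag _ (hmem z' hz').1]
        exact hP z' π π' (fun a ha => hag a ((hmem z' hz').2 ha)) _ (hπ z' hz'))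
      (fun π π' hag => hP z π π' (fun a ha => hag a (mem_union_right _ ha))) (hK z)
    have key' : #{π : Equiv.Perm α | (∀ a ∈ T, P a π (π (p a))) ∧ P z π (π (p z))} *
        (Fintype.card α - #F') ≤ #{π : Equiv.Perm α | ∀ a ∈ T, P a π (π (p a))} * K := by
      convert key
    have hset : (univ.filter fun π : Equiv.Perm α => ∀ a ∈ insert z T, P a π (π (p a))) =
        univ.filter fun π : Equiv.Perm α => (∀ a ∈ T, P a π (π (p a))) ∧ P z π (π (p z)) := by
      ext π
      simp [and_comm]
    rw [hset, pow_succ, pow_succ]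
    calc _ = #{π : Equiv.Perm α | (∀ a ∈ T, P a π (π (p a))) ∧ P z π (π (p z))} * h * h ^ #T := by
          ring
      _ ≤ #{π : Equiv.Perm α | ∀ a ∈ T, P a π (π (p a))} * K * h ^ #T := by
          refine Nat.mul_le_mul_right _ (le_trans (Nat.mul_le_mul_left _ ?_) key')
          omega
      _ = (#{π : Equiv.Perm α | ∀ a ∈ T, P a π (π (p a))} * h ^ #T) * K := by ring
      _ ≤ (K ^ #T * Fintype.card (Equiv.Perm α)) * K := Nat.mul_le_mul_right _ ih'
      _ = _ := by ring

open Classical in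
/-- Union bound over the `t`-element subsets of `R`. -/
theorem card_perm_le_card_filter_mul_pow_le {α Z : Type*} [Fintype α] [DecidableEq α]
    (p : Z → α) (F : Z → Finset α) (P : Z → Equiv.Perm α → α → Prop) (K h t : ℕ)
    (hF : ∀ z, #(F z) ≤ 1)
    (hP : ∀ z, ∀ π π' : Equiv.Perm α, (∀ a ∈ F z, π a = π' a) → ∀ v, P z π v → P z π' v)
    (hK : ∀ z π, #{v | P z π v} ≤ K) (R : Finset Z) (hp : Set.InjOn p R)
    (hpF : ∀ z ∈ R, ∀ z' ∈ R, p z ∉ F z') (ht : 2 * t + h ≤ Fintype.card α) :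
    #{π : Equiv.Perm α | t ≤ #{z ∈ R | P z π (π (p z))}} * h ^ t ≤
      (#R).choose t * (K ^ t * Fintype.card (Equiv.Perm α)) := by
  have hsub : (univ.filter fun π : Equiv.Perm α => t ≤ #{z ∈ R | P z π (π (p z))}) ⊆
      (R.powersetCard t).biUnion fun T => univ.filter fun π => ∀ z ∈ T, P z π (π (p z)) := by
    intro π hπ
    obtain ⟨T, hT, hTt⟩ := exists_subset_card_eq (mem_filter.1 hπ).2
    refine mem_biUnion.2 ⟨T, mem_powersetCard.2 ⟨hT.trans (filter_subset _ _), hTt⟩,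
      mem_filter.2 ⟨mem_univ _, fun z hz => (mem_filter.1 (hT hz)).2⟩⟩
  calc _ ≤ (∑ T ∈ R.powersetCard t, #{π : Equiv.Perm α | ∀ z ∈ T, P z π (π (p z))}) * h ^ t :=
        Nat.mul_le_mul_right _ ((card_le_card hsub).trans card_biUnion_le)
    _ = ∑ T ∈ R.powersetCard t, #{π : Equiv.Perm α | ∀ z ∈ T, P z π (π (p z))} * h ^ t := by
        rw [sum_mul]
    _ ≤ ∑ T ∈ R.powersetCard t, K ^ t * Fintype.card (Equiv.Perm α) := by
        refine sum_le_sum fun T hT => ?_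
        obtain ⟨hTR, rfl⟩ := mem_powersetCard.1 hT
        exact card_perm_forall_mul_pow_le p F P K h hF hP hK T (hp.mono (by exact_mod_cast hTR))
          (fun a ha b hb => hpF a (hTR ha) b (hTR hb)) ht
    _ = _ := by rw [sum_const, card_powersetCard, smul_eq_mul]

theorem card_bits (m : ℕ) : Fintype.card (Bits m) = 2 ^ m := by
  simp [Bits]

/-- Since `t! ≥ (t / e) ^ t` and `e < 3`, a threshold of six times `a` leaves a factor `1 / 2` per
element. -/
theorem pow_div_factorial_le_half_pow {a : ℝ} (ha : 0 ≤ a) {t : ℕ} (hat : 6 * a ≤ t) :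
    a ^ t / t.factorial ≤ (1 / 2) ^ t := by
  have h1 : (t : ℝ) ^ t / t.factorial ≤ Real.exp t :=
    Real.pow_div_factorial_le_exp _ (by positivity) t
  have h2 : Real.exp t ≤ 3 ^ t := by
    rw [← Real.exp_one_pow]
    exact pow_le_pow_left₀ (Real.exp_pos _).le Real.exp_one_lt_three.le t
  calc a ^ t / t.factorial ≤ (t / 6 : ℝ) ^ t / t.factorial := by gcongr; linarith
    _ = (t : ℝ) ^ t / t.factorial / 6 ^ t := by rw [div_pow]; ring
    _ ≤ 3 ^ t / 6 ^ t := by gcongr; exact h1.trans h2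
    _ = (1 / 2) ^ t := by rw [← div_pow]; norm_num

open Classical in
/-- Tail bound for the number of `z ∈ R` such that the first component of `π (p z)` is a value
determined by at most one other value of `π`. -/
theorem card_perm_fst_collisions_le {r c t : ℕ} (ht : 12 * 2 ^ c ≤ t * 2 ^ r) (h2 : 2 ≤ r)
    (p : Bits c → Bits r × Bits c) (F : Bits c → Finset (Bits r × Bits c))
    (g : Bits c → Equiv.Perm (Bits r × Bits c) → Bits r) (hF : ∀ z, #(F z) ≤ 1)
    (hg : ∀ z, ∀ π π' : Equiv.Perm (Bits r × Bits c),
      (∀ a ∈ F z, π a = π' a) → g z π = g z π')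
    (R : Finset (Bits c)) (hp : Set.InjOn p R) (hpF : ∀ z ∈ R, ∀ z' ∈ R, p z ∉ F z') :
    (#{π : Equiv.Perm (Bits r × Bits c) | t ≤ #{z ∈ R | (π (p z)).1 = g z π}} : ℝ) ≤
      (1 / 2) ^ t * Fintype.card (Equiv.Perm (Bits r × Bits c)) := by
  -- For `t > 2 ^ c` the event is empty. Otherwise `r ≥ 2` gives `2 * t ≤ 2 ^ (r + c - 1)`, so half
  -- of all values are still free throughout the revealing process.
  rcases lt_or_ge (2 ^ c) t with htc | htc
  · have : (univ.filter fun π : Equiv.Perm (Bits r × Bits c) =>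
        t ≤ #{z ∈ R | (π (p z)).1 = g z π}) = ∅ := by
      refine filter_eq_empty_iff.2 fun π _ hle => ?_
      have := hle.trans (card_le_univ _)
      rw [card_bits] at this
      omega
    rw [this]
    simp
  have hα : Fintype.card (Bits r × Bits c) = 2 * 2 ^ (r + c - 1) := by
    rw [Fintype.card_prod, card_bits, card_bits, ← pow_add, ← pow_succ']
    congr 1
    omega
  have hhalf : 2 * t + 2 ^ (r + c - 1) ≤ Fintype.card (Bits r × Bits c) := by
    have : 2 ^ (c + 1) ≤ 2 ^ (r + c - 1) := Nat.pow_le_pow_right (by norm_num) (by omega)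
    rw [pow_succ] at this
    omega
  have key := card_perm_le_card_filter_mul_pow_le p F (fun z π v => v.1 = g z π) (2 ^ c)
    (2 ^ (r + c - 1)) t hF (fun z π π' hag v hv => by rw [← hg z π π' hag]; exact hv)
    (fun z π => by
      rw [← card_bits c, ← Finset.card_univ]
      refine card_le_card_of_injOn Prod.snd (fun _ _ => by simp) fun u hu v hv huv => ?_
      simp only [coe_filter, mem_univ, true_and, Set.mem_ofPred_eq] at hu hv
      exact Prod.ext (hu.trans hv.symm) huv) R hp hpF hhalf
  have hX₀ : #{π : Equiv.Perm (Bits r × Bits c) | t ≤ #{z ∈ R | (π (p z)).1 = g z π}} *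
      (2 ^ (r + c - 1)) ^ t ≤
        (#R).choose t * ((2 ^ c) ^ t * Fintype.card (Equiv.Perm (Bits r × Bits c))) := by
    convert key
  clear key
  generalize #{π : Equiv.Perm (Bits r × Bits c) | t ≤ #{z ∈ R | (π (p z)).1 = g z π}} = X
    at hX₀ ⊢
  generalize Fintype.card (Equiv.Perm (Bits r × Bits c)) = N at hX₀ ⊢
  have key' : (X : ℝ) * (2 ^ (r + c - 1)) ^ t ≤ ((#R).choose t : ℝ) * ((2 ^ c) ^ t * N) := by
    exact_mod_cast hX₀
  have hchoose : ((#R).choose t : ℝ) ≤ (2 ^ c) ^ t / t.factorial := by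
    refine (Nat.choose_le_pow_div t (#R)).trans ?_
    have : (#R : ℝ) ≤ 2 ^ c := by
      have := card_le_univ R
      rw [card_bits] at this
      exact_mod_cast this
    gcongr
  -- Twice the estimate `2 ^ c / 2 ^ r` of the mean; the factor two comes from having only half of
  -- the values guaranteed free.
  set a : ℝ := 2 ^ c * 2 ^ c / 2 ^ (r + c - 1) with ha
  have ha' : a = 2 * 2 ^ c / 2 ^ r := by
    have : (2 : ℝ) ^ r * 2 ^ c = 2 * 2 ^ (r + c - 1) := by
      rw [← pow_add, ← pow_succ']
      congr 1
      omega
    rw [ha, div_eq_div_iff (by positivity) (by positivity)]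
    linear_combination 2 ^ c * this
  have hat : 6 * a ≤ t := by
    rw [ha', ← mul_div_assoc, div_le_iff₀ (by positivity)]
    have : (12 * 2 ^ c : ℝ) ≤ t * 2 ^ r := by exact_mod_cast ht
    linarith
  have hX : (X : ℝ) ≤ a ^ t / t.factorial * N := by
    have hpos : (0 : ℝ) < (2 ^ (r + c - 1)) ^ t := by positivity
    rw [← le_div_iff₀ hpos] at key'
    refine key'.trans ?_
    calc _ ≤ (2 ^ c : ℝ) ^ t / t.factorial * ((2 ^ c) ^ t * N) / (2 ^ (r + c - 1)) ^ t := by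
          gcongr
      _ = _ := by rw [ha, div_pow, mul_pow]; ring
  exact hX.trans (mul_le_mul_of_nonneg_right
    (pow_div_factorial_le_half_pow (by positivity) hat) (by positivity))

open Classical in
/-- The first components of the values of `π` are evenly distributed over every coset of the
capacity part, and have few coincidences between different cosets or shifts. -/
def IsSpread {r c : ℕ} (M : ℕ) (π : Equiv.Perm (Bits r × Bits c)) : Prop :=
  (∀ x u, #{z | (π (x, z)).1 = u} ≤ M) ∧
    ∀ x₁ x₂ w, (x₁ ≠ x₂ ∨ w ≠ 0) → #{z | (π (x₁, z)).1 = (π (x₂, z + w)).1} ≤ M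

/-- A coordinate where `w` is nonzero distinguishes every point from its translate. Within one
colour class the revealed points and the points conditioned on are then disjoint, even inside a
single coset. -/
theorem exists_bits_coloring {c : ℕ} (w : Bits c) :
    ∃ ρ : Bits c → ZMod 2, w ≠ 0 → ∀ z z', ρ z = ρ z' → z ≠ z' + w := by
  by_cases hw : w = 0
  · exact ⟨fun _ => 0, fun h => absurd hw h⟩
  obtain ⟨i, hi⟩ := Function.ne_iff.1 hw
  refine ⟨fun z => z i, fun _ z z' h hz => hi ?_⟩
  replace h : z i = z' i := h
  have := congrFun hz i
  rw [Pi.add_apply, h] at this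
  simpa using this

-- There are at most `2 ^ (4 * (r + c))` conditions, each failing with probability at most `2 ^ (-t)
-- ≤ 2 ^ (-5 * (r + c))`. The spread constant is `2 * t` because pair coincidences are counted
-- separately in two colour classes. For `r = 1` the tail bound is unavailable, but `ht1` makes
-- every count trivially small.
open Classical in
theorem card_not_isSpread_le {r c t : ℕ} (hr : 0 < r) (ht : 12 * 2 ^ c ≤ t * 2 ^ r)
    (htn : 5 * (r + c) ≤ t) (ht1 : r = 1 → 2 ^ c < t) :
    (#{π : Equiv.Perm (Bits r × Bits c) | ¬ IsSpread (2 * t) π} : ℝ) ≤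
      1 / 2 ^ (r + c) * Fintype.card (Equiv.Perm (Bits r × Bits c)) := by
  set N : ℕ := Fintype.card (Equiv.Perm (Bits r × Bits c))
  rcases Nat.lt_or_ge r 2 with h1 | h2
  · have hlt := ht1 (by omega)
    have hle : ∀ s : Finset (Bits c), #s ≤ 2 * t := fun s => by
      have := card_le_univ s
      rw [card_bits] at this
      omega
    have : (univ.filter fun π : Equiv.Perm (Bits r × Bits c) => ¬ IsSpread (2 * t) π) = ∅ :=
      filter_eq_empty_iff.2 fun π _ h => h ⟨fun _ _ => hle _, fun _ _ _ _ => hle _⟩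
    rw [this]
    simp only [card_empty, Nat.cast_zero]
    positivity
  choose ρ hρ using fun w : Bits c => exists_bits_coloring w
  set E₁ : Bits r × Bits r → Finset (Equiv.Perm (Bits r × Bits c)) := fun i =>
    univ.filter fun π => t ≤ #{z ∈ (univ : Finset (Bits c)) | (π (i.1, z)).1 = i.2}
  set E₂ : (Bits r × Bits r) × Bits c × ZMod 2 → Finset (Equiv.Perm (Bits r × Bits c)) := fun i =>
    if i.1.1 ≠ i.1.2 ∨ i.2.1 ≠ 0 then
      univ.filter fun π => t ≤ #{z ∈ univ.filter (fun z => ρ i.2.1 z = i.2.2) |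
        (π (i.1.2, z + i.2.1)).1 = (π (i.1.1, z)).1}
    else ∅
  have hE₁ : ∀ i, (#(E₁ i) : ℝ) ≤ (1 / 2) ^ t * N := fun i =>
    card_perm_fst_collisions_le ht h2 (fun z => (i.1, z)) (fun _ => ∅) (fun _ _ => i.2)
      (by simp) (fun _ _ _ _ => rfl) univ (fun a _ b _ h => (Prod.ext_iff.1 h).2) (by simp)
  have hE₂ : ∀ i, (#(E₂ i) : ℝ) ≤ (1 / 2) ^ t * N := by
    intro i
    by_cases hi : i.1.1 ≠ i.1.2 ∨ i.2.1 ≠ 0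
    · simp only [E₂, if_pos hi]
      refine card_perm_fst_collisions_le ht h2 (fun z => (i.1.2, z + i.2.1))
        (fun z => {(i.1.1, z)}) (fun z π => (π (i.1.1, z)).1) (by simp)
        (fun z π π' h => by rw [h _ (mem_singleton_self _)]) _
        (fun a _ b _ h => add_right_cancel (Prod.ext_iff.1 h).2) ?_
      intro z hz z' hz' hmem
      rw [mem_singleton, Prod.ext_iff] at hmem
      rcases hi with hi | hi
      · exact hi hmem.1.symm
      · refine hρ i.2.1 hi z' z ?_ hmem.2.symm
        rw [(mem_filter.1 hz).2, (mem_filter.1 hz').2]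
    · simp only [E₂, if_neg hi, card_empty, Nat.cast_zero]
      positivity
  have hsub : (univ.filter fun π : Equiv.Perm (Bits r × Bits c) => ¬ IsSpread (2 * t) π) ⊆
      univ.biUnion E₁ ∪ univ.biUnion E₂ := by
    intro π hπ
    by_contra hcon
    simp only [mem_union, mem_biUnion, mem_univ, true_and, not_or, not_exists] at hcon
    refine (mem_filter.1 hπ).2 ⟨fun x u => ?_, fun x₁ x₂ w hne => ?_⟩
    · have := hcon.1 (x, u)
      simp only [E₁, mem_filter, mem_univ, true_and, not_le] at this
      omega
    · have hj : ∀ j, #{z ∈ univ.filter (fun z => ρ w z = j) |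
          (π (x₂, z + w)).1 = (π (x₁, z)).1} < t := by
        intro j
        have := hcon.2 ((x₁, x₂), (w, j))
        simpa only [E₂, if_pos hne, mem_filter, mem_univ, true_and, not_le] using this
      have hsplit : (univ.filter fun z => (π (x₁, z)).1 = (π (x₂, z + w)).1) ⊆
          (univ : Finset (ZMod 2)).biUnion fun j => (univ.filter (fun z => ρ w z = j)).filter
            fun z => (π (x₂, z + w)).1 = (π (x₁, z)).1 := by
        intro z hz
        simp only [mem_biUnion, mem_filter, mem_univ, true_and] at hz ⊢
        exact ⟨ρ w z, rfl, hz.symm⟩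
      refine (card_le_card hsplit).trans ((card_biUnion_le_card_mul _ _ t
        fun j _ => (hj j).le).trans ?_)
      simp [ZMod.card]
  have hcount : (#{π : Equiv.Perm (Bits r × Bits c) | ¬ IsSpread (2 * t) π} : ℝ) ≤
      (2 ^ (2 * r) + 2 ^ (2 * r + c + 1)) * ((1 / 2) ^ t * N) := by
    have h1 : (#{π : Equiv.Perm (Bits r × Bits c) | ¬ IsSpread (2 * t) π} : ℝ) ≤
        ∑ i, (#(E₁ i) : ℝ) + ∑ i, (#(E₂ i) : ℝ) := by
      exact_mod_cast (card_le_card hsub).trans ((card_union_le _ _).trans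
        (Nat.add_le_add card_biUnion_le card_biUnion_le))
    refine h1.trans ?_
    rw [add_mul]
    refine add_le_add ((sum_le_sum fun i _ => hE₁ i).trans_eq ?_)
      ((sum_le_sum fun i _ => hE₂ i).trans_eq ?_)
    · rw [sum_const, nsmul_eq_mul, card_univ, Fintype.card_prod, card_bits]
      push_cast
      ring
    · rw [sum_const, nsmul_eq_mul, card_univ, Fintype.card_prod, Fintype.card_prod,
        Fintype.card_prod, card_bits, card_bits, ZMod.card]
      push_cast
      ring
  refine hcount.trans ?_
  rw [← mul_assoc]
  refine mul_le_mul_of_nonneg_right ?_ (by positivity)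
  have h3 : (2 ^ (2 * r) + 2 ^ (2 * r + c + 1) : ℝ) ≤ 2 ^ (4 * (r + c)) := by
    calc (2 ^ (2 * r) + 2 ^ (2 * r + c + 1) : ℝ)
        ≤ 2 ^ (2 * r + c + 1) + 2 ^ (2 * r + c + 1) := by
          have : (2 : ℝ) ^ (2 * r) ≤ 2 ^ (2 * r + c + 1) :=
            pow_le_pow_right₀ (by norm_num) (by omega)
          linarith
      _ = 2 ^ (2 * r + c + 2) := by ring
      _ ≤ 2 ^ (4 * (r + c)) := pow_le_pow_right₀ (by norm_num) (by omega)
  have h4 : ((1 / 2 : ℝ)) ^ t ≤ (1 / 2) ^ (5 * (r + c)) :=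
    pow_le_pow_of_le_one (by norm_num) (by norm_num) htn
  calc _ ≤ (2 : ℝ) ^ (4 * (r + c)) * (1 / 2) ^ (5 * (r + c)) := by gcongr
    _ = 1 / 2 ^ (r + c) := by
      rw [one_div_pow, mul_one_div, div_eq_div_iff (by positivity) (by positivity)]
      ring

end RandomPermutations

/-! ### Extending a good database by one value. -/

section Extension

variable {r c : ℕ} {π : Equiv.Perm (Bits r × Bits c)} {D D' : Database r c}

/-- The recursion only asks for entries to be present, never to be absent; this is what makes
badness persist under adding entries. -/
theorem IsTail.mono (hk : ∀ x y, D.dbK x = some y → D'.dbK x = some y)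
    (hk' : ∀ x y, D.dbK' x = some y → D'.dbK' x = some y) {z : Bits c} {l : List (Bits r)}
    (h : IsTail π D z l) : IsTail π D' z l := by
  induction h with
  | nil => exact .nil
  | step _ hxp hxi hπ ih => exact .step ih (hk _ _ hxp) (hk' _ _ hxi) hπ

theorem intermediatePairs_mono (hk : ∀ x y, D.dbK x = some y → D'.dbK x = some y)
    (hk' : ∀ x y, D.dbK' x = some y → D'.dbK' x = some y) :
    intermediatePairs π D ⊆ intermediatePairs π D' := by
  rintro p ⟨xp, yp, zp, h, ⟨l, hl⟩, hp⟩
  exact ⟨xp, yp, zp, hk _ _ h, ⟨l, IsTail.mono hk hk' hl⟩, hp⟩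

theorem BAD_mono (hk : ∀ x y, D.dbK x = some y → D'.dbK x = some y)
    (hk' : ∀ x y, D.dbK' x = some y → D'.dbK' x = some y) (h : D ∈ BAD π) : D' ∈ BAD π := by
  rcases h with ⟨z, hz⟩ | ⟨p, hp, p', hp', h⟩
  · exact .inl ⟨z, hz.trans (Set.encard_le_encard fun l hl => IsTail.mono hk hk' hl)⟩
  · exact .inr ⟨p, intermediatePairs_mono hk hk' hp, p', intermediatePairs_mono hk hk' hp', h⟩

theorem mem_BAD_of_update_none {i : OracleInput r c} {v : Option (Bits (outLen i))}
    (h : Function.update D i none ∈ BAD π) : Function.update D i v ∈ BAD π := by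
  have key : ∀ j y, Function.update D i none j = some y → Function.update D i v j = some y := by
    intro j y hj
    rcases eq_or_ne j i with rfl | hji
    · simp at hj
    · rwa [Function.update_of_ne hji] at hj ⊢
  exact BAD_mono (D := Function.update D i none) (fun x y hx => key (.inl (.inl x)) y hx)
    (fun x y hx => key (.inl (.inr x)) y hx) h

theorem two_le_encard_tails_iff {z : Bits c} :
    2 ≤ (tails π D z).encard ↔ ∃ l l', IsTail π D z l ∧ IsTail π D z l' ∧ l ≠ l' := by
  have h2 : (2 : ℕ∞) = 1 + 1 := by norm_num
  rw [h2, ENat.add_one_le_iff (by simp), Set.one_lt_encard_iff]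
  simp [tails]

theorem not_mem_BAD_iff : D ∉ BAD π ↔
    (∀ z l l', IsTail π D z l → IsTail π D z l' → l = l') ∧
      ∀ x z z', (x, z) ∈ intermediatePairs π D → (x, z') ∈ intermediatePairs π D → z = z' := by
  simp only [BAD, Set.mem_ofPred_eq, not_or, not_exists, two_le_encard_tails_iff]
  refine and_congr ?_ ?_
  · refine forall_congr' fun z => forall_congr' fun l => forall_congr' fun l' => ?_
    tauto
  · constructor
    · intro h x z z' hz hz'
      by_contra hne
      exact h (x, z) ⟨hz, (x, z'), hz', rfl, hne⟩
    · rintro h ⟨x, z⟩ ⟨hz, ⟨x', z'⟩, hz', rfl, hne⟩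
      exact hne (h _ _ _ hz hz')

theorem emptyDatabase_not_mem_BAD : emptyDatabase r c ∉ BAD π := by
  have hnil : ∀ z l, IsTail π (emptyDatabase r c) z l → l = [] := by
    intro z l h
    induction h with
    | nil => rfl
    | step _ h => cases h
  refine not_mem_BAD_iff.2 ⟨?_, ?_⟩
  · intro z l l' h h'
    rw [hnil z l h, hnil z l' h']
  · rintro x z z' ⟨_, _, _, h, _⟩
    cases h

/-- The capacity values that have a tail. -/
def reachable (π : Equiv.Perm (Bits r × Bits c)) (D : Database r c) : Set (Bits c) :=
  {z | ∃ l, IsTail π D z l}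

/-- The first components that a new intermediate pair has to avoid. -/
def occupied (π : Equiv.Perm (Bits r × Bits c)) (D : Database r c) : Set (Bits r) :=
  {x | D.dbK' x ≠ none} ∪ Prod.fst '' intermediatePairs π D

theorem IsTail.reachable {z : Bits c} {l : List (Bits r)} (h : IsTail π D z l) :
    z ∈ reachable π D := ⟨l, h⟩

theorem mem_intermediatePairs_of_reachable {x : Bits r} {y z : Bits c} (hx : D.dbK x = some y)
    (hz : z ∈ reachable π D) : π (x, z + y) ∈ intermediatePairs π D :=
  ⟨x, y, z, hx, hz, rfl⟩

/-- A new value of `h` does not matter for `BAD`. -/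
theorem update_h_not_mem_BAD (hD : D ∉ BAD π) (z : Bits c)
    (v : Option (Bits (outLen (.inr z : OracleInput r c)))) :
    Function.update D (.inr z) v ∉ BAD π := by
  have hne : ∀ j, Function.update D (.inr z) v (.inl j) = D (.inl j) := fun j =>
    Function.update_of_ne (by simp) _ _
  exact fun h => hD (BAD_mono (D := Function.update D (.inr z) v)
    (fun x y hx => (hne (.inl x)).symm.trans hx)
    (fun x y hx => (hne (.inr x)).symm.trans hx) h)

/-- A new value of `k` at `x` that does not make the database bad. -/
theorem update_k_not_mem_BAD (hD : D ∉ BAD π) {x : Bits r} {y : Bits c}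
    (hocc : ∀ z ∈ reachable π D, (π (x, z + y)).1 ∉ occupied π D)
    (hcol : ∀ z ∈ reachable π D, ∀ z' ∈ reachable π D, z ≠ z' →
      (π (x, z + y)).1 ≠ (π (x, z' + y)).1) :
    Function.update D (.inl (.inl x)) (some y) ∉ BAD π := by
  obtain ⟨htail, hip⟩ := not_mem_BAD_iff.1 hD
  set E : Database r c := Function.update D (.inl (.inl x)) (some y) with hE
  have hk' : ∀ x', E.dbK' x' = D.dbK' x' := fun x' =>
    show E (.inl (.inr x')) = D (.inl (.inr x')) from Function.update_of_ne (by simp) _ _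
  have hk : ∀ x' y', E.dbK x' = some y' → D.dbK x' = some y' ∨ (x' = x ∧ y' = y) := by
    intro x' y' h
    rcases eq_or_ne x' x with rfl | hne
    · right
      simp only [hE, Database.dbK, Function.update_self] at h
      exact ⟨rfl, (Option.some.inj h).symm⟩
    · left
      rwa [hE, Database.dbK, Function.update_of_ne (by simpa using hne)] at h
  -- A tail step through the new `k` entry would require a `k'` entry at its intermediate block,
  -- which `hocc` excludes; so no tails are created.
  have hold : ∀ z l, IsTail π E z l → IsTail π D z l := by
    intro z l h
    induction h with
    | nil => exact .nil
    | step _ hxp hxi hπ ih =>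
      rw [hk'] at hxi
      rcases hk _ _ hxp with hxp | ⟨rfl, rfl⟩
      · exact .step ih hxp hxi hπ
      · refine absurd (Or.inl ?_) (hocc _ ih.reachable)
        rw [← hπ, Set.mem_ofPred_eq, hxi]
        simp
  have hnew : ∀ p ∈ intermediatePairs π E, p ∈ intermediatePairs π D ∨
      ∃ z ∈ reachable π D, p = π (x, z + y) := by
    rintro p ⟨xp, yp, zp, hxp, ⟨l, hl⟩, rfl⟩
    rcases hk _ _ hxp with hxp | ⟨rfl, rfl⟩
    · exact .inl ⟨xp, yp, zp, hxp, ⟨l, hold _ _ hl⟩, rfl⟩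
    · exact .inr ⟨zp, ⟨l, hold _ _ hl⟩, rfl⟩
  have hmix : ∀ a z z', (a, z) ∈ intermediatePairs π D →
      (∃ w ∈ reachable π D, (a, z') = π (x, w + y)) → False := by
    rintro a z z' h ⟨w, hw, hw'⟩
    refine hocc w hw (.inr ⟨_, h, ?_⟩)
    rw [← hw']
  refine not_mem_BAD_iff.2 ⟨fun z l l' h h' => htail z l l' (hold _ _ h) (hold _ _ h'), ?_⟩
  intro a z z' h h'
  rcases hnew _ h with h | h <;> rcases hnew _ h' with h' | h'
  · exact hip _ _ _ h h'
  · exact (hmix _ _ _ h h').elim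
  · exact (hmix _ _ _ h' h).elim
  · obtain ⟨w, hw, hw'⟩ := h
    obtain ⟨v, hv, hveq⟩ := h'
    rcases eq_or_ne w v with rfl | hne
    · exact (Prod.ext_iff.1 (hw'.trans hveq.symm)).2
    · refine absurd ?_ (hcol w hw v hv hne)
      rw [← hw', ← hveq]

/-- A new value of `k'` at `x` that does not make the database bad. -/
theorem update_k'_not_mem_BAD (hD : D ∉ BAD π) {x : Bits r} {y : Bits c}
    (hreach : ∀ z, (x, z) ∈ intermediatePairs π D → z + y ∉ reachable π D)
    (hocc : ∀ z, (x, z) ∈ intermediatePairs π D → ∀ xp yp, D.dbK xp = some yp →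
      (π (xp, z + y + yp)).1 ∉ insert x (occupied π D))
    (hcol : ∀ z, (x, z) ∈ intermediatePairs π D → ∀ xp yp, D.dbK xp = some yp →
      ∀ xp' yp', D.dbK xp' = some yp' → xp ≠ xp' →
        (π (xp, z + y + yp)).1 ≠ (π (xp', z + y + yp')).1) :
    Function.update D (.inl (.inr x)) (some y) ∉ BAD π := by
  obtain ⟨htail, hip⟩ := not_mem_BAD_iff.1 hD
  set E : Database r c := Function.update D (.inl (.inr x)) (some y) with hE
  have hk : ∀ x', E.dbK x' = D.dbK x' := fun x' =>
    show E (.inl (.inl x')) = D (.inl (.inl x')) from Function.update_of_ne (by simp) _ _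
  have hk' : ∀ x' y', E.dbK' x' = some y' → D.dbK' x' = some y' ∨ (x' = x ∧ y' = y) := by
    intro x' y' h
    rcases eq_or_ne x' x with rfl | hne
    · right
      simp only [hE, Database.dbK', Function.update_self] at h
      exact ⟨rfl, (Option.some.inj h).symm⟩
    · left
      rwa [hE, Database.dbK', Function.update_of_ne (by simpa using hne)] at h
  -- The new `k'` entry can only be used in the last step of a tail: continuing beyond it needs a
  -- next intermediate block in `insert x (occupied π D)`. Inserting `x` rules out a second use of
  -- the new entry itself.
  have hold : ∀ z l, IsTail π E z l → IsTail π D z l ∨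
      ∃ zi zp xp yp l', IsTail π D zp l' ∧ D.dbK xp = some yp ∧ (x, zi) = π (xp, zp + yp) ∧
        z = zi + y ∧ l = l' ++ [xp] := by
    intro z l h
    induction h with
    | nil => exact .inl .nil
    | @step zp zi yp yi xp xi l _ hxp hxi hπ ih =>
      rw [hk] at hxp
      rcases ih with ih | ⟨zi₀, zp₀, xp₀, yp₀, l₀, hl₀, hxp₀, hπ₀, rfl, rfl⟩
      · rcases hk' _ _ hxi with hxi | ⟨rfl, rfl⟩
        · exact .inl (.step ih hxp hxi hπ)
        · exact .inr ⟨zi, zp, xp, yp, l, ih, hxp, hπ, rfl, rfl⟩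
      · have hmem : (x, zi₀) ∈ intermediatePairs π D := by
          rw [hπ₀]
          exact mem_intermediatePairs_of_reachable hxp₀ hl₀.reachable
        refine absurd ?_ (hocc _ hmem xp yp hxp)
        rw [← hπ]
        rcases hk' _ _ hxi with hxi | ⟨rfl, rfl⟩
        · refine Set.mem_insert_of_mem _ (.inl ?_)
          rw [Set.mem_ofPred_eq, hxi]
          simp
        · exact Set.mem_insert _ _
  have hnew : ∀ p ∈ intermediatePairs π E, p ∈ intermediatePairs π D ∨
      ∃ z xp yp, (x, z) ∈ intermediatePairs π D ∧ D.dbK xp = some yp ∧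
        p = π (xp, z + y + yp) := by
    rintro p ⟨xp, yp, zp, hxp, ⟨l, hl⟩, rfl⟩
    rw [hk] at hxp
    rcases hold _ _ hl with hl | ⟨zi₀, zp₀, xp₀, yp₀, l₀, hl₀, hxp₀, hπ₀, rfl, rfl⟩
    · exact .inl ⟨xp, yp, zp, hxp, ⟨l, hl⟩, rfl⟩
    · refine .inr ⟨zi₀, xp, yp, ?_, hxp, rfl⟩
      rw [hπ₀]
      exact mem_intermediatePairs_of_reachable hxp₀ hl₀.reachable
  have hmix : ∀ a z z', (a, z) ∈ intermediatePairs π D →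
      (∃ w xp yp, (x, w) ∈ intermediatePairs π D ∧ D.dbK xp = some yp ∧
        (a, z') = π (xp, w + y + yp)) → False := by
    rintro a z z' h ⟨w, xp, yp, hw, hxp, hw'⟩
    refine hocc w hw xp yp hxp (.inr (.inr ⟨_, h, ?_⟩))
    rw [← hw']
  have hmixtail : ∀ z l, IsTail π D z l →
      (∃ zi zp xp yp l', IsTail π D zp l' ∧ D.dbK xp = some yp ∧ (x, zi) = π (xp, zp + yp) ∧
        z = zi + y) → False := by
    rintro z l h ⟨zi, zp, xp, yp, l', hl', hxp, hπ, rfl⟩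
    refine hreach zi ?_ h.reachable
    rw [hπ]
    exact mem_intermediatePairs_of_reachable hxp hl'.reachable
  refine not_mem_BAD_iff.2 ⟨?_, ?_⟩
  · intro z l l' h h'
    rcases hold _ _ h with h | ⟨zi, zp, xp, yp, m, hm, hxp, hπ, hz, hl⟩ <;>
      rcases hold _ _ h' with h' | ⟨zi', zp', xp', yp', m', hm', hxp', hπ', hz', hl'⟩
    · exact htail _ _ _ h h'
    · exact (hmixtail _ _ h ⟨zi', zp', xp', yp', m', hm', hxp', hπ', hz'⟩).elim
    · exact (hmixtail _ _ h' ⟨zi, zp, xp, yp, m, hm, hxp, hπ, hz⟩).elim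
    -- When both tails end with the new entry, injectivity of `π` recovers the last block and the
    -- preceding capacity value; the remaining prefixes agree because `D` is good.
    · obtain rfl : zi = zi' := add_right_cancel (hz.symm.trans hz')
      obtain ⟨rfl, h2⟩ := Prod.ext_iff.1 (π.injective (hπ.symm.trans hπ'))
      obtain rfl : yp = yp' := Option.some.inj (hxp.symm.trans hxp')
      obtain rfl : zp = zp' := add_right_cancel h2
      rw [hl, hl', htail _ _ _ hm hm']
  · intro a z z' h h'
    rcases hnew _ h with h | h <;> rcases hnew _ h' with h' | h'
    · exact hip _ _ _ h h'
    · exact (hmix _ _ _ h h').elim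
    · exact (hmix _ _ _ h' h).elim
    · obtain ⟨w, xp, yp, hw, hxp, hw'⟩ := h
      obtain ⟨v, xp', yp', hv, hxp', hv'⟩ := h'
      obtain rfl : w = v := hip _ _ _ hw hv
      rcases eq_or_ne xp xp' with rfl | hne
      · obtain rfl : yp = yp' := Option.some.inj (hxp.symm.trans hxp')
        exact (Prod.ext_iff.1 (hw'.trans hv'.symm)).2
      · refine absurd ?_ (hcol w hw xp yp hxp xp' yp' hxp' hne)
        rw [← hw', ← hv']

end Extension

/-! ### Counting harmful values for a spread permutation. -/

section Counting

open Finset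

variable {r c : ℕ} {π : Equiv.Perm (Bits r × Bits c)} {D : Database r c}

/-- The number of entries of a database. -/
def dbSize (D : Database r c) : ℕ := #{i | D i ≠ none}

theorem card_dbK_le : #{x | D.dbK x ≠ none} ≤ dbSize D :=
  card_le_card_of_injOn (fun x => .inl (.inl x)) (fun x hx =>
    mem_filter.2 ⟨mem_univ _, (mem_filter.1 hx).2⟩)
    fun x _ y _ h => by simpa using h

theorem card_dbK'_le : #{x | D.dbK' x ≠ none} ≤ dbSize D :=
  card_le_card_of_injOn (fun x => .inl (.inr x)) (fun x hx =>
    mem_filter.2 ⟨mem_univ _, (mem_filter.1 hx).2⟩)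
    fun x _ y _ h => by simpa using h

-- In a good database the intermediate block determines its capacity part, so each `k'` entry
-- produces at most one reachable value. The extra one is the root `0`.
open Classical in
theorem card_reachable_le (hD : D ∉ BAD π) : #{z | z ∈ reachable π D} ≤ dbSize D + 1 := by
  obtain ⟨-, hip⟩ := not_mem_BAD_iff.1 hD
  have hch : ∀ x : Bits r, ∃ w : Bits c, ∀ z, (x, z) ∈ intermediatePairs π D → z = w := by
    intro x
    by_cases h : ∃ w, (x, w) ∈ intermediatePairs π D
    · obtain ⟨w, hw⟩ := h
      exact ⟨w, fun z hz => hip _ _ _ hz hw⟩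
    · exact ⟨0, fun z hz => (h ⟨z, hz⟩).elim⟩
  choose w hw using hch
  have hsub : (univ.filter fun z => z ∈ reachable π D) ⊆
      insert 0 ((univ.filter fun x => D.dbK' x ≠ none).image
        fun x => w x + (D.dbK' x).getD 0) := by
    intro z hz
    obtain ⟨l, hl⟩ := (mem_filter.1 hz).2
    cases hl with
    | nil => exact mem_insert_self _ _
    | @step zp zi yp yi xp xi l hl hxp hxi hπ =>
      refine mem_insert_of_mem (mem_image.2 ⟨xi, by simp [hxi], ?_⟩)
      rw [hxi, Option.getD_some, ← hw xi zi]
      rw [hπ]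
      exact mem_intermediatePairs_of_reachable hxp hl.reachable
  refine (card_le_card hsub).trans ((card_insert_le _ _).trans ?_)
  exact Nat.succ_le_succ (card_image_le.trans card_dbK'_le)

open Classical in
theorem card_occupied_le (hD : D ∉ BAD π) :
    #{x | x ∈ occupied π D} ≤ dbSize D + dbSize D * (dbSize D + 1) := by
  have hsub : (univ.filter fun x => x ∈ occupied π D) ⊆
      (univ.filter fun x => D.dbK' x ≠ none) ∪
        ((univ.filter fun x => D.dbK x ≠ none) ×ˢ (univ.filter fun z => z ∈ reachable π D)).image
          fun p => (π (p.1, p.2 + (D.dbK p.1).getD 0)).1 := by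
    intro x hx
    rcases (mem_filter.1 hx).2 with h | ⟨p, ⟨xp, yp, zp, hxp, hzp, rfl⟩, rfl⟩
    · exact mem_union_left _ (mem_filter.2 ⟨mem_univ _, h⟩)
    · refine mem_union_right _ (mem_image.2 ⟨(xp, zp), ?_, by simp [hxp]⟩)
      simp only [mem_product, mem_filter, mem_univ, true_and]
      exact ⟨by simp [hxp], hzp⟩
  refine (card_le_card hsub).trans ((card_union_le _ _).trans
    (Nat.add_le_add card_dbK'_le (card_image_le.trans ?_)))
  rw [card_product]
  exact Nat.mul_le_mul card_dbK_le (card_reachable_le hD)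

open Classical in
/-- The number of new values at `i` that make a good database bad. -/
theorem card_update_mem_BAD_le {M s : ℕ} (hM : 0 < M) (hπ : IsSpread M π) (hD : D ∉ BAD π)
    (hs : dbSize D < s) (i : OracleInput r c) :
    #{y | Function.update D i (some y) ∈ BAD π} * 2 ^ c ≤ 3 * s ^ 3 * M * 2 ^ outLen i := by
  set Z : Finset (Bits c) := univ.filter fun z => z ∈ reachable π D
  set S : Finset (Bits r) := univ.filter fun x => x ∈ occupied π D
  set X : Finset (Bits r) := univ.filter fun x => D.dbK x ≠ none
  have hZ : #Z ≤ s := (card_reachable_le hD).trans hs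
  have hX : #X ≤ s := card_dbK_le.trans hs.le
  -- With `m = dbSize D`, the bound is `m + m * (m + 1) + 1 = (m + 1) ^ 2`. The added one makes room
  -- for `insert x S` in the `k'` case.
  have hS : #S + 1 ≤ s ^ 2 := by
    have h1 : #S ≤ _ := card_occupied_le hD
    have h2 : (dbSize D + 1) ^ 2 ≤ s ^ 2 := Nat.pow_le_pow_left hs 2
    nlinarith
  have hs1 : 1 ≤ s := by omega
  have hfib : ∀ (x : Bits r) (b : Bits c) (u : Bits r), #{y | (π (x, b + y)).1 = u} ≤ M := by
    intro x b u
    refine le_trans (card_le_card_of_injOn (fun y => b + y) ?_ ?_) (hπ.1 x u)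
    · intro y hy
      simpa using hy
    · exact fun _ _ _ _ h => add_left_cancel h
  have hpair : ∀ (x x' : Bits r) (b b' : Bits c), (x ≠ x' ∨ b ≠ b') →
      #{y | (π (x, b + y)).1 = (π (x', b' + y)).1} ≤ M := by
    intro x x' b b' hne
    refine le_trans (card_le_card_of_injOn (fun y => b + y) ?_ ?_) (hπ.2 x x' (b' - b)
      (hne.imp_right fun h h' => h (sub_eq_zero.1 h').symm))
    · intro y hy
      have : b + y + (b' - b) = b' + y := by abel
      simpa [this] using hy
    · exact fun _ _ _ _ h => add_left_cancel h
  rcases i with (x | x) | z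
  · change #{y : Bits c | _} * 2 ^ c ≤ _ * 2 ^ c
    refine Nat.mul_le_mul_right _ ?_
    -- A harmful `k` value makes a new intermediate block meet an occupied one or another new one:
    -- at most `s ^ 3 + s ^ 2` coincidences, each for at most `M` values.
    have hsub : (univ.filter fun y : Bits c =>
        Function.update D (.inl (.inl x)) (some y) ∈ BAD π) ⊆
        ((Z ×ˢ S).biUnion fun p => univ.filter fun y => (π (x, p.1 + y)).1 = p.2) ∪
        (((Z ×ˢ Z).filter fun p => p.1 ≠ p.2).biUnion fun p =>
          univ.filter fun y => (π (x, p.1 + y)).1 = (π (x, p.2 + y)).1) := by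
      intro y hy
      by_contra hcon
      rw [mem_union, not_or, mem_biUnion, mem_biUnion] at hcon
      refine update_k_not_mem_BAD hD ?_ ?_ (mem_filter.1 hy).2
      · intro z hz hocc
        refine hcon.1 ⟨(z, (π (x, z + y)).1), ?_, by simp⟩
        simp only [mem_product, Z, S, mem_filter, mem_univ, true_and]
        exact ⟨hz, hocc⟩
      · intro z hz z' hz' hne heq
        refine hcon.2 ⟨(z, z'), ?_, by simpa using heq⟩
        simp only [mem_product, Z, mem_filter, mem_univ, true_and]
        exact ⟨⟨hz, hz'⟩, hne⟩
    have h1 : #((Z ×ˢ S).biUnion fun p => univ.filter fun y => (π (x, p.1 + y)).1 = p.2) ≤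
        s * s ^ 2 * M := by
      refine (card_biUnion_le_card_mul _ _ M fun p _ => hfib _ _ _).trans ?_
      rw [card_product]
      gcongr
      omega
    have h2 : #(((Z ×ˢ Z).filter fun p => p.1 ≠ p.2).biUnion fun p =>
        univ.filter fun y => (π (x, p.1 + y)).1 = (π (x, p.2 + y)).1) ≤ s * s * M := by
      refine (card_biUnion_le_card_mul _ _ M fun p hp => hpair _ _ _ _
        (.inr (mem_filter.1 hp).2)).trans ?_
      refine Nat.mul_le_mul_right _ ((card_filter_le _ _).trans ?_)
      rw [card_product]
      gcongr
    refine (card_le_card hsub).trans ((card_union_le _ _).trans ((Nat.add_le_add h1 h2).trans ?_))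
    have : s * s * M ≤ s * s * M * s := Nat.le_mul_of_pos_right _ hs1
    nlinarith
  · change #{y : Bits c | _} * 2 ^ c ≤ _ * 2 ^ c
    refine Nat.mul_le_mul_right _ ?_
    by_cases hz : ∃ z, (x, z) ∈ intermediatePairs π D
    swap
    · refine (card_eq_zero.2 (filter_eq_empty_iff.2 fun y _ => ?_)).trans_le (Nat.zero_le _)
      push Not at hz
      exact update_k'_not_mem_BAD hD (fun z h => absurd h (hz z)) (fun z h => absurd h (hz z))
        (fun z h => absurd h (hz z))
    obtain ⟨z, hz⟩ := hz
    have huniq : ∀ z', (x, z') ∈ intermediatePairs π D → z' = z := fun z' hz' =>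
      (not_mem_BAD_iff.1 hD).2 _ _ _ hz' hz
    -- The unique capacity part `z` and the `k` entry are merged into one offset, so the next
    -- permutation input has the form `(xp, v xp + y)` required by `hfib` and `hpair`.
    set v : Bits r → Bits c := fun x => z + (D.dbK x).getD 0
    have hsub : (univ.filter fun y : Bits c =>
        Function.update D (.inl (.inr x)) (some y) ∈ BAD π) ⊆
        (univ.filter fun y => z + y ∈ reachable π D) ∪
        (((X ×ˢ insert x S).biUnion fun p =>
          univ.filter fun y => (π (p.1, v p.1 + y)).1 = p.2) ∪
        (((X ×ˢ X).filter fun p => p.1 ≠ p.2).biUnion fun p =>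
          univ.filter fun y => (π (p.1, v p.1 + y)).1 = (π (p.2, v p.2 + y)).1)) := by
      intro y hy
      by_contra hcon
      rw [mem_union, mem_union, not_or, not_or, mem_biUnion, mem_biUnion, mem_filter] at hcon
      have hv : ∀ xp yp, D.dbK xp = some yp → z + y + yp = v xp + y := by
        intro xp yp h
        simp only [v, h, Option.getD_some]
        abel
      refine update_k'_not_mem_BAD hD ?_ ?_ ?_ (mem_filter.1 hy).2
      · intro z' hz' hreach
        rw [huniq z' hz'] at hreach
        exact hcon.1 ⟨mem_univ _, hreach⟩
      · intro z' hz' xp yp hxp hocc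
        rw [huniq z' hz', hv xp yp hxp] at hocc
        refine hcon.2.1 ⟨(xp, (π (xp, v xp + y)).1), ?_, by simp⟩
        refine mem_product.2 ⟨by simp [X, hxp], ?_⟩
        rw [mem_insert]
        exact hocc.imp_right fun h => mem_filter.2 ⟨mem_univ _, h⟩
      · intro z' hz' xp yp hxp xp' yp' hxp' hne heq
        rw [huniq z' hz', hv xp yp hxp, hv xp' yp' hxp'] at heq
        refine hcon.2.2 ⟨(xp, xp'), ?_, by simpa using heq⟩
        simp [X, hxp, hxp', hne]
    have h0 : #{y | z + y ∈ reachable π D} ≤ s := by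
      refine le_trans (card_le_card_of_injOn (fun y => z + y) ?_ ?_) hZ
      · intro y hy
        simpa [Z] using hy
      · exact fun _ _ _ _ h => add_left_cancel h
    have h1 : #((X ×ˢ insert x S).biUnion fun p =>
        univ.filter fun y => (π (p.1, v p.1 + y)).1 = p.2) ≤ s * s ^ 2 * M := by
      refine (card_biUnion_le_card_mul _ _ M fun p _ => hfib _ _ _).trans ?_
      rw [card_product]
      gcongr
      exact (card_insert_le _ _).trans hS
    have h2 : #(((X ×ˢ X).filter fun p => p.1 ≠ p.2).biUnion fun p =>
        univ.filter fun y => (π (p.1, v p.1 + y)).1 = (π (p.2, v p.2 + y)).1) ≤ s * s * M := by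
      refine (card_biUnion_le_card_mul _ _ M fun p hp => hpair _ _ _ _
        (.inl (mem_filter.1 hp).2)).trans ?_
      refine Nat.mul_le_mul_right _ ((card_filter_le _ _).trans ?_)
      rw [card_product]
      gcongr
    refine (card_le_card hsub).trans ((card_union_le _ _).trans (Nat.add_le_add h0
      ((card_union_le _ _).trans (Nat.add_le_add h1 h2)) |>.trans ?_))
    have h3 : s * s * M ≤ s * s * M * s := Nat.le_mul_of_pos_right _ hs1
    have h4 : s ≤ s * (s * s * M) := Nat.le_mul_of_pos_right _ (by positivity)
    nlinarith
  · refine le_trans (le_of_eq ?_) (Nat.zero_le _)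
    rw [card_eq_zero.2 (filter_eq_empty_iff.2 fun y _ => update_h_not_mem_BAD hD z (some y)),
      zero_mul]

end Counting

/-! ### The compression as an involution. -/

section Compression

open Finset

/-- The square root of the number of bit strings of length `m`. -/
noncomputable def sqrtCard (m : ℕ) : ℝ := Real.sqrt (2 ^ m)

theorem sqrtCard_pos (m : ℕ) : 0 < sqrtCard m := Real.sqrt_pos.2 (by positivity)

theorem sqrtCard_mul_self (m : ℕ) : sqrtCard m * sqrtCard m = 2 ^ m :=
  Real.mul_self_sqrt (by positivity)

theorem sqrtCard_inv_mul_inv_mul_card (m : ℕ) :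
    ((sqrtCard m : ℂ)⁻¹ * (sqrtCard m : ℂ)⁻¹) * 2 ^ m = 1 := by
  have h : (sqrtCard m : ℂ) * sqrtCard m = 2 ^ m := by
    rw [← Complex.ofReal_mul, sqrtCard_mul_self]
    push_cast
    rfl
  rw [← mul_inv, h, inv_mul_cancel₀ (pow_ne_zero _ two_ne_zero)]

theorem entryCompression_none_none (m : ℕ) : entryCompression m none none = 0 := by
  simp [entryCompression, Matrix.vecMulVec, ketBot, ketMu]

theorem entryCompression_none_some (m : ℕ) (x : Bits m) :
    entryCompression m none (some x) = (sqrtCard m : ℂ)⁻¹ := by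
  simp [entryCompression, Matrix.vecMulVec, ketBot, ketMu, sqrtCard]

theorem entryCompression_some_none (m : ℕ) (x : Bits m) :
    entryCompression m (some x) none = (sqrtCard m : ℂ)⁻¹ := by
  simp [entryCompression, Matrix.vecMulVec, ketBot, ketMu, sqrtCard]

theorem entryCompression_some_some (m : ℕ) (x y : Bits m) :
    entryCompression m (some x) (some y) =
      (if x = y then 1 else 0) - (sqrtCard m : ℂ)⁻¹ * (sqrtCard m : ℂ)⁻¹ := by
  simp [entryCompression, Matrix.vecMulVec, ketBot, ketMu, sqrtCard, Matrix.one_apply]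

theorem sum_entryCompression_none (m : ℕ) (f : Option (Bits m) → ℂ) :
    ∑ e, entryCompression m none e * f e = (sqrtCard m : ℂ)⁻¹ * ∑ x, f (some x) := by
  rw [Fintype.sum_option, entryCompression_none_none, zero_mul, zero_add, mul_sum]
  simp only [entryCompression_none_some]

theorem sum_entryCompression_some (m : ℕ) (f : Option (Bits m) → ℂ) (x : Bits m) :
    ∑ e, entryCompression m (some x) e * f e = f (some x) +
      (sqrtCard m : ℂ)⁻¹ * (f none - (sqrtCard m : ℂ)⁻¹ * ∑ y, f (some y)) := by
  rw [Fintype.sum_option, entryCompression_some_none]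
  simp only [entryCompression_some_some, sub_mul, sum_sub_distrib, ite_mul, one_mul, zero_mul,
    sum_ite_eq, mem_univ, if_true, ← mul_sum]
  ring

theorem entryCompression_symm (m : ℕ) (e e' : Option (Bits m)) :
    entryCompression m e e' = entryCompression m e' e := by
  cases e <;> cases e' <;>
    simp [entryCompression_none_some, entryCompression_some_none, entryCompression_some_some,
      eq_comm]

theorem star_entryCompression (m : ℕ) (e e' : Option (Bits m)) :
    star (entryCompression m e e') = entryCompression m e e' := by
  cases e <;> cases e' <;>
    simp only [entryCompression_none_none, entryCompression_none_some, entryCompression_some_none,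
      entryCompression_some_some, star_zero, star_sub, star_mul, star_inv₀, RCLike.star_def,
      Complex.conj_ofReal]
  split_ifs <;> simp

/-- The entry compression exchanges the orthonormal vectors `ketBot` and `ketMu` and fixes their
orthogonal complement, hence squares to the identity. -/
theorem sum_entryCompression_mul_self (m : ℕ) (e e' : Option (Bits m)) :
    ∑ a, entryCompression m e a * entryCompression m a e' = if e = e' then 1 else 0 := by
  have hcard := sqrtCard_inv_mul_inv_mul_card m
  have hsum : ∀ y : Bits m, ∑ x, ((if x = y then (1 : ℂ) else 0) -
      (sqrtCard m : ℂ)⁻¹ * (sqrtCard m : ℂ)⁻¹) = 0 := by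
    intro y
    rw [sum_sub_distrib, sum_ite_eq', if_pos (mem_univ _), sum_const, card_univ, card_bits,
      nsmul_eq_mul]
    push_cast
    linear_combination -hcard
  cases e with
  | none =>
    rw [sum_entryCompression_none]
    cases e' with
    | none =>
      simp only [entryCompression_some_none, sum_const, card_univ, card_bits, nsmul_eq_mul]
      push_cast
      linear_combination hcard
    | some y =>
      simp only [entryCompression_some_some, hsum]
      simp
  | some x =>
    rw [sum_entryCompression_some]
    cases e' with
    | none =>
      simp only [entryCompression_some_none, entryCompression_none_none, sum_const, card_univ,
        card_bits, nsmul_eq_mul]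
      push_cast
      linear_combination -(sqrtCard m : ℂ)⁻¹ * hcard
    | some y =>
      simp only [entryCompression_some_some, entryCompression_none_some, hsum]
      simp

variable {r c : ℕ}

/-- A weight depending only on entry `i` sits in one tensor factor. In all other factors compression
and decompression cancel, which makes a query local. -/
theorem sum_compression_mul_compression (i : OracleInput r c) (D D'' : Database r c)
    (g : Option (Bits (outLen i)) → ℂ) :
    ∑ D', compression r c D D' * compression r c D' D'' * g (D' i) =
      (∏ j ∈ univ.erase i, if D j = D'' j then (1 : ℂ) else 0) *
        ∑ e, entryCompression _ (D i) e * entryCompression _ e (D'' i) * g e := by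
  set W : (j : OracleInput r c) → Option (Bits (outLen j)) → ℂ :=
    Function.update (fun _ _ => 1) i g
  have hW : ∀ D' : Database r c, ∏ j, W j (D' j) = g (D' i) := by
    intro D'
    rw [Fintype.prod_eq_single i]
    · simp [W]
    · intro j hj
      simp [W, Function.update_of_ne hj]
  have h1 : ∀ D' : Database r c, compression r c D D' * compression r c D' D'' * g (D' i) =
      ∏ j, entryCompression _ (D j) (D' j) * entryCompression _ (D' j) (D'' j) * W j (D' j) := by
    intro D'
    rw [prod_mul_distrib, prod_mul_distrib, hW]
    rfl
  simp only [h1]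
  have h2 := prod_univ_sum (fun j : OracleInput r c => (univ : Finset (Option (Bits (outLen j)))))
    (fun j e => entryCompression _ (D j) e * entryCompression _ e (D'' j) * W j e)
  rw [Fintype.piFinset_univ] at h2
  rw [← h2, ← mul_prod_erase _ _ (mem_univ i), mul_comm]
  congr 1
  · refine prod_congr rfl fun j hj => ?_
    rw [← sum_entryCompression_mul_self]
    refine sum_congr rfl fun e _ => ?_
    simp [W, Function.update_of_ne (ne_of_mem_erase hj)]
  · simp [W]

theorem compression_conjTranspose : (compression r c).conjTranspose = compression r c := by
  ext D D'
  rw [Matrix.conjTranspose_apply]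
  simp only [compression, Matrix.of_apply]
  rw [star_prod]
  exact prod_congr rfl fun i _ => by rw [star_entryCompression, entryCompression_symm]

theorem compression_mul_self : compression r c * compression r c = 1 := by
  ext D D''
  have h2 := prod_univ_sum (fun j : OracleInput r c => (univ : Finset (Option (Bits (outLen j)))))
    (fun j e => entryCompression _ (D j) e * entryCompression _ e (D'' j))
  rw [Fintype.piFinset_univ] at h2
  simp only [prod_mul_distrib, sum_entryCompression_mul_self] at h2
  rw [Matrix.mul_apply, Matrix.one_apply]
  refine h2.symm.trans ?_
  by_cases h : D = D''
  · simp [h]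
  · rw [if_neg h]
    obtain ⟨j, hj⟩ := Function.ne_iff.1 h
    exact prod_eq_zero (mem_univ j) (if_neg hj)

end Compression

/-! ### The compressed oracle in coordinates. -/

section Oracle

open Finset

variable {r c d : ℕ}

theorem onDatabase_mulVec (M : Matrix (Database r c) (Database r c) ℂ)
    (v : JointBasis r c d → ℂ) (a : AlgBasis r c d) (D : Database r c) :
    (onDatabase d M).mulVec v (a, D) = ∑ D', M D D' * v (a, D') := by
  simp only [Matrix.mulVec, dotProduct, onDatabase, Matrix.kroneckerMap_apply]
  rw [Fintype.sum_prod_type, Fintype.sum_eq_single a]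
  · simp
  · intro a' ha'
    simp [Matrix.one_apply_ne ha'.symm]

theorem onAlg_mulVec (U : Matrix (AlgBasis r c d) (AlgBasis r c d) ℂ)
    (v : JointBasis r c d → ℂ) (a : AlgBasis r c d) (D : Database r c) :
    (onAlg U).mulVec v (a, D) = ∑ a', U a a' * v (a', D) := by
  simp only [Matrix.mulVec, dotProduct, onAlg, Matrix.kroneckerMap_apply]
  rw [Fintype.sum_prod_type_right, Fintype.sum_eq_single D]
  · simp
  · intro D' hD'
    simp [Matrix.one_apply_ne hD'.symm]

theorem purifiedOracle_mulVec (v : JointBasis r c d → ℂ) (i : OracleInput r c)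
    (y : Bits (outLen i)) (w : Fin d) (D : Database r c) :
    (purifiedOracle r c d).mulVec v ((⟨i, y⟩, w), D) =
      v ((⟨i, y - (D i).getD 0⟩, w), D) := by
  simp only [Matrix.mulVec, dotProduct, purifiedOracle, Matrix.of_apply]
  rw [Fintype.sum_eq_single ((⟨i, y - (D i).getD 0⟩, w), D)]
  · simp [purifiedStep]
  · rintro ⟨⟨⟨i', y'⟩, w'⟩, D'⟩ hne
    rw [if_neg, zero_mul]
    intro h
    apply hne
    simp only [purifiedStep, Prod.mk.injEq, Sigma.mk.injEq] at h
    obtain ⟨⟨⟨rfl, h⟩, rfl⟩, rfl⟩ := h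
    rw [eq_of_heq h]
    simp

theorem onDatabase_compression_conjTranspose :
    (onDatabase d (compression r c)).conjTranspose = onDatabase d (compression r c) := by
  rw [onDatabase, Matrix.conjTranspose_kronecker, compression_conjTranspose,
    Matrix.conjTranspose_one]

/-- A query changes only the queried entry of the database. -/
theorem compressedOracle_mulVec (v : JointBasis r c d → ℂ) (i : OracleInput r c)
    (y : Bits (outLen i)) (w : Fin d) (D : Database r c) :
    (compressedOracle r c d).mulVec v ((⟨i, y⟩, w), D) =
      ∑ e', entryCompression _ (D i) e' * ∑ e, entryCompression _ e' e *
        v ((⟨i, y - e'.getD 0⟩, w), Function.update D i e) := by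
  rw [compressedOracle, onDatabase_compression_conjTranspose, ← Matrix.mulVec_mulVec,
    ← Matrix.mulVec_mulVec, onDatabase_mulVec]
  simp only [purifiedOracle_mulVec, onDatabase_mulVec, mul_sum]
  rw [sum_comm]
  have h1 : ∀ D'' : Database r c, ∑ D', compression r c D D' * (compression r c D' D'' *
      v ((⟨i, y - (D' i).getD 0⟩, w), D'')) =
      (∏ j ∈ univ.erase i, if D j = D'' j then (1 : ℂ) else 0) *
        ∑ e, entryCompression _ (D i) e * entryCompression _ e (D'' i) *
          v ((⟨i, y - e.getD 0⟩, w), D'') := by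
    intro D''
    rw [← sum_compression_mul_compression i D D''
      (fun e => v ((⟨i, y - e.getD 0⟩, w), D''))]
    simp only [mul_assoc]
  simp only [h1]
  have hinj : Function.Injective (fun e => Function.update D i e) :=
    Function.update_injective D i
  -- The product of indicators kills every database that differs from `D` away from `i`, leaving
  -- only the updates at `i`.
  rw [← sum_subset (subset_univ (univ.image fun e => Function.update D i e)),
    sum_image (fun a _ b _ h => hinj h), sum_comm]
  · refine sum_congr rfl fun e _ => ?_
    rw [prod_eq_one, one_mul]
    · refine sum_congr rfl fun e' _ => ?_
      rw [Function.update_self, mul_assoc]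
    · intro j hj
      rw [Function.update_of_ne (ne_of_mem_erase hj), if_pos rfl]
  · intro D'' _ hD''
    have : ∃ j, j ≠ i ∧ D j ≠ D'' j := by
      by_contra hcon
      push Not at hcon
      refine hD'' (mem_image.2 ⟨D'' i, mem_univ _, ?_⟩)
      funext j
      rcases eq_or_ne j i with rfl | hj
      · simp
      · rw [Function.update_of_ne hj, hcon j hj]
    obtain ⟨j, hj, hne⟩ := this
    rw [prod_eq_zero (mem_erase.2 ⟨hj, mem_univ j⟩) (if_neg hne), zero_mul]

end Oracle

/-! ### A query to a single entry. -/

section EntryBound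

open Finset

/-- Translation of a function on bit strings. -/
def shiftBits {m : ℕ} (x : Bits m) (v : EuclideanSpace ℂ (Bits m)) : EuclideanSpace ℂ (Bits m) :=
  WithLp.toLp 2 fun y => v (y - x)

theorem norm_shiftBits {m : ℕ} (x : Bits m) (v : EuclideanSpace ℂ (Bits m)) :
    ‖shiftBits x v‖ = ‖v‖ := by
  rw [EuclideanSpace.norm_eq, EuclideanSpace.norm_eq]
  congr 1
  exact Equiv.sum_comp (Equiv.subRight x) fun y => ‖v y‖ ^ 2

/-- If the values in `L` have amplitude zero before a query, their total weight after the query is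
`O(|L| / 2 ^ m)`. -/
theorem sum_norm_sq_entry_query_le (m : ℕ) (f : Bits m → Option (Bits m) → ℂ)
    (L : Finset (Bits m)) (hf : ∀ y, ∀ x ∈ L, f y (some x) = 0) :
    ∑ x ∈ L, ∑ y, ‖∑ e', entryCompression m (some x) e' * ∑ e, entryCompression m e' e *
        f (y - e'.getD 0) e‖ ^ 2 ≤
      36 * (#L / 2 ^ m) * ∑ e, ∑ y, ‖f y e‖ ^ 2 := by
  set s : ℝ := sqrtCard m with hs
  have hs0 : 0 < s := sqrtCard_pos m
  have hss : s * s = 2 ^ m := sqrtCard_mul_self m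
  set a : EuclideanSpace ℂ (Bits m) := WithLp.toLp 2 fun y => f y none with ha
  set g : Bits m → EuclideanSpace ℂ (Bits m) := fun x => WithLp.toLp 2 fun y => f y (some x)
    with hg
  set b : EuclideanSpace ℂ (Bits m) := (s : ℂ)⁻¹ • ∑ x, g x with hb
  -- Here `a` is the `⊥` component, `b` the `μ` component, and `G x` the component at value `x`
  -- after decompressing, shifting and compressing, when `g x = 0`. Every surviving term carries the
  -- factor `1 / s`, that is `2 ^ (-m / 2)`.
  set G : Bits m → EuclideanSpace ℂ (Bits m) := fun x => (s : ℂ)⁻¹ • (shiftBits x (a - b) +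
    (b - (s : ℂ)⁻¹ • ∑ x', shiftBits x' (g x' + (s : ℂ)⁻¹ • (a - b)))) with hG
  set S : ℝ := ∑ e, ∑ y, ‖f y e‖ ^ 2 with hS
  have hS' : S = ‖a‖ ^ 2 + ∑ x, ‖g x‖ ^ 2 := by
    rw [hS, Fintype.sum_option]
    simp only [EuclideanSpace.norm_sq_eq, ha, hg]
  have hSa : ‖a‖ ≤ √S := by
    refine Real.le_sqrt_of_sq_le ?_
    rw [hS']
    have : 0 ≤ ∑ x, ‖g x‖ ^ 2 := by positivity
    linarith
  -- Cauchy–Schwarz over the `2 ^ m` values; the loss `s` is cancelled by the normalization of `μ`.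
  have hSg : ∑ x, ‖g x‖ ≤ s * √S := by
    have h1 : (∑ x, ‖g x‖) ^ 2 ≤ 2 ^ m * ∑ x, ‖g x‖ ^ 2 := by
      have := sq_sum_le_card_mul_sum_sq (s := (univ : Finset (Bits m))) (f := fun x => ‖g x‖)
      rw [card_univ, card_bits] at this
      exact_mod_cast this
    have h2 : s * √S = √(2 ^ m * S) := by
      rw [Real.sqrt_mul (by positivity), hs, sqrtCard]
    rw [h2]
    refine Real.le_sqrt_of_sq_le (h1.trans ?_)
    rw [hS']
    have : 0 ≤ ‖a‖ ^ 2 := by positivity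
    gcongr
    linarith
  have hnorm_inv : ‖(s : ℂ)⁻¹‖ = s⁻¹ := by
    rw [norm_inv, Complex.norm_real, Real.norm_of_nonneg hs0.le]
  have hbS : ‖b‖ ≤ √S := by
    rw [hb, norm_smul, hnorm_inv]
    calc s⁻¹ * ‖∑ x, g x‖ ≤ s⁻¹ * (s * √S) := by
          gcongr
          exact (norm_sum_le _ _).trans hSg
      _ = √S := by field_simp
  have habS : ‖a - b‖ ≤ 2 * √S := (norm_sub_le _ _).trans (by linarith)
  have hmean : ‖(s : ℂ)⁻¹ • ∑ x', shiftBits x' (g x' + (s : ℂ)⁻¹ • (a - b))‖ ≤ 3 * √S := by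
    rw [norm_smul, hnorm_inv]
    have h1 : ‖∑ x', shiftBits x' (g x' + (s : ℂ)⁻¹ • (a - b))‖ ≤ s * √S + s * (2 * √S) := by
      calc _ ≤ ∑ x', (‖g x'‖ + s⁻¹ * (2 * √S)) := by
            refine norm_sum_le_of_le _ fun x' _ => ?_
            rw [norm_shiftBits]
            refine (norm_add_le _ _).trans ?_
            rw [norm_smul, hnorm_inv]
            gcongr
        _ = ∑ x', ‖g x'‖ + 2 ^ m * (s⁻¹ * (2 * √S)) := by
            rw [sum_add_distrib, sum_const, card_univ, card_bits, nsmul_eq_mul]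
            push_cast
            rfl
        _ ≤ s * √S + s * (2 * √S) := by
            have : 2 ^ m * (s⁻¹ * (2 * √S)) = s * (2 * √S) := by
              rw [← hss]
              field_simp
            rw [this]
            gcongr
    calc _ ≤ s⁻¹ * (s * √S + s * (2 * √S)) := by gcongr
      _ = 3 * √S := by field_simp; ring
  have hGS : ∀ x, ‖G x‖ ^ 2 ≤ 36 / 2 ^ m * S := by
    intro x
    -- The constant is `2 + 1 + 3`, from `a - b`, `b` and the averaged term.
    have h1 : ‖G x‖ ≤ s⁻¹ * (6 * √S) := by
      rw [hG, norm_smul, hnorm_inv]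
      gcongr
      refine (norm_add_le _ _).trans ?_
      rw [norm_shiftBits]
      have := norm_sub_le b ((s : ℂ)⁻¹ • ∑ x', shiftBits x' (g x' + (s : ℂ)⁻¹ • (a - b)))
      linarith
    have hS0 : 0 ≤ S := by rw [hS]; positivity
    calc ‖G x‖ ^ 2 ≤ (s⁻¹ * (6 * √S)) ^ 2 := by gcongr
      _ = 36 / (s * s) * (√S * √S) := by field_simp; ring
      _ = 36 / 2 ^ m * S := by rw [hss, Real.mul_self_sqrt hS0]
  have hexp : ∀ x ∈ L, ∀ y, ∑ e', entryCompression m (some x) e' *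
      ∑ e, entryCompression m e' e * f (y - e'.getD 0) e = G x y := by
    intro x hx y
    have hb' : ∀ y, b y = (s : ℂ)⁻¹ * ∑ x, f y (some x) := by
      intro y
      simp [hb, hg]
    have hnone : ∑ e, entryCompression m none e * f (y - (none : Option (Bits m)).getD 0) e =
        b y := by
      rw [sum_entryCompression_none, hb']
      simp [hs]
    have hsome : ∀ x, ∑ e, entryCompression m (some x) e * f (y - (some x).getD 0) e =
        shiftBits x (g x + (s : ℂ)⁻¹ • (a - b)) y := by
      intro x
      rw [sum_entryCompression_some, Option.getD_some]
      simp [shiftBits, hg, ha, hb', hs]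
    rw [sum_entryCompression_some]
    simp only [hnone, hsome]
    have hzero : shiftBits x (g x + (s : ℂ)⁻¹ • (a - b)) y =
        (s : ℂ)⁻¹ * shiftBits x (a - b) y := by
      simp [shiftBits, hg, hf _ x hx]
    rw [hzero, hG]
    simp only [PiLp.smul_apply, PiLp.add_apply, PiLp.sub_apply, WithLp.ofLp_sum, Finset.sum_apply,
      smul_eq_mul, ← hs]
    ring
  calc _ = ∑ x ∈ L, ‖G x‖ ^ 2 := by
        refine sum_congr rfl fun x hx => ?_
        rw [EuclideanSpace.norm_sq_eq]
        exact sum_congr rfl fun y _ => by rw [hexp x hx y]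
    _ ≤ ∑ x ∈ L, 36 / 2 ^ m * S := sum_le_sum fun x _ => hGS x
    _ = _ := by
        rw [sum_const, nsmul_eq_mul]
        ring

end EntryBound

/-! ### From one entry to the whole database. -/

section Transition

open Finset

variable {r c d : ℕ}

/-- Groups the databases into fibres over those empty at `i`. A query at `i` preserves each fibre,
so the single-entry bound applies fibrewise. -/
theorem sum_database_eq_sum_update (i : OracleInput r c) (φ : Database r c → ℝ) :
    ∑ D, φ D = ∑ D ∈ univ.filter (fun D : Database r c => D i = none),
      ∑ e, φ (Function.update D i e) := by
  rw [sum_sigma']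
  symm
  refine sum_nbij' (fun p => Function.update p.1 i p.2)
    (fun D => ⟨Function.update D i none, D i⟩) ?_ ?_ ?_ ?_ ?_
  · intro p _
    exact mem_univ _
  · intro D _
    simp
  · rintro ⟨D, e⟩ h
    have hD : D i = none := by simpa using h
    have : Function.update D i none = D := by rw [← hD, Function.update_eq_self]
    simp [this]
  · intro D _
    simp
  · intro p _
    rfl

theorem sum_jointBasis (φ : JointBasis r c d → ℝ) :
    ∑ s, φ s = ∑ i : OracleInput r c, ∑ w : Fin d, ∑ D : Database r c, ∑ y : Bits (outLen i),
      φ ((⟨i, y⟩, w), D) := by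
  rw [Fintype.sum_prod_type, Fintype.sum_prod_type, Fintype.sum_sigma]
  refine sum_congr rfl fun i _ => ?_
  rw [sum_comm]
  refine sum_congr rfl fun w _ => ?_
  rw [sum_comm]

open Classical in
/-- One query: if a vector is supported on databases in `P`, and for each entry the fraction of
the values that lead from `P` to `Q` is at most `γ`, the weight on `Q` after the query is
`O(γ)`. -/
theorem sum_norm_sq_compressedOracle_le {P Q : Set (Database r c)} {γ : ℝ} (hPQ : Disjoint P Q)
    (h : ∀ i (D : Database r c), D i = none → (∀ e, Function.update D i e ∉ P) ∨
      (D ∉ Q ∧ (#{y | Function.update D i (some y) ∈ Q} : ℝ) ≤ γ * 2 ^ outLen i))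
    (v : JointBasis r c d → ℂ) (hv : ∀ a D, D ∉ P → v (a, D) = 0) :
    ∑ s, (if s.2 ∈ Q then ‖(compressedOracle r c d).mulVec v s‖ ^ 2 else 0) ≤
      36 * γ * ∑ s, ‖v s‖ ^ 2 := by
  rw [sum_jointBasis, sum_jointBasis, mul_sum]
  refine sum_le_sum fun i _ => ?_
  rw [mul_sum]
  refine sum_le_sum fun w _ => ?_
  rw [sum_database_eq_sum_update i, sum_database_eq_sum_update i, mul_sum]
  refine sum_le_sum fun D hD => ?_
  have hDi : D i = none := (mem_filter.1 hD).2
  simp only [compressedOracle_mulVec, Function.update_self, Function.update_idem]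
  have hrhs : 0 ≤ ∑ e, ∑ y, ‖v ((⟨i, y⟩, w), Function.update D i e)‖ ^ 2 := by positivity
  rcases h i D hDi with hP | ⟨hDQ, hcard⟩
  · have hzero : ∀ y e, v ((⟨i, y⟩, w), Function.update D i e) = 0 := fun y e => hv _ _ (hP e)
    simp [hzero]
  · have hnone : Function.update D i none ∉ Q := by rwa [← hDi, Function.update_eq_self]
    rw [Fintype.sum_option]
    simp only [if_neg hnone, sum_const_zero, zero_add]
    have key := sum_norm_sq_entry_query_le (outLen i)
      (fun y e => v ((⟨i, y⟩, w), Function.update D i e))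
      (univ.filter fun y => Function.update D i (some y) ∈ Q)
      (fun y x hx => hv _ _ fun hP => Set.disjoint_left.1 hPQ hP (mem_filter.1 hx).2)
    rw [sum_filter] at key
    refine le_trans (le_of_eq ?_) (key.trans ?_)
    · refine sum_congr rfl fun x _ => ?_
      split_ifs <;> simp
    · refine mul_le_mul_of_nonneg_right ?_ hrhs
      refine mul_le_mul_of_nonneg_left ?_ (by norm_num)
      rwa [div_le_iff₀ (by positivity)]

theorem dbSize_le_update (D : Database r c) (i : OracleInput r c) (e : Option (Bits (outLen i))) :
    dbSize D ≤ dbSize (Function.update D i e) + 1 := by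
  refine le_trans (card_le_card (t := insert i (univ.filter fun j =>
    Function.update D i e j ≠ none)) ?_) (card_insert_le _ _)
  intro j hj
  rcases eq_or_ne j i with rfl | hji
  · exact mem_insert_self _ _
  · refine mem_insert_of_mem (mem_filter.2 ⟨mem_univ _, ?_⟩)
    rw [Function.update_of_ne hji]
    exact (mem_filter.1 hj).2

theorem dbSize_update_none_le (D : Database r c) (i : OracleInput r c) (hi : D i = none)
    (e : Option (Bits (outLen i))) : dbSize D ≤ dbSize (Function.update D i e) := by
  refine card_le_card fun j hj => ?_
  have hj' := (mem_filter.1 hj).2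
  have hji : j ≠ i := by
    rintro rfl
    exact hj' hi
  refine mem_filter.2 ⟨mem_univ _, ?_⟩
  rwa [Function.update_of_ne hji]

/-- A query adds at most one entry to the database. -/
theorem compressedOracle_mulVec_eq_zero {t : ℕ} (v : JointBasis r c d → ℂ)
    (hv : ∀ a D, t < dbSize D → v (a, D) = 0) (a : AlgBasis r c d) (D : Database r c)
    (hD : t + 1 < dbSize D) : (compressedOracle r c d).mulVec v (a, D) = 0 := by
  obtain ⟨⟨i, y⟩, w⟩ := a
  rw [compressedOracle_mulVec]
  refine sum_eq_zero fun e' _ => ?_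
  rw [sum_eq_zero, mul_zero]
  intro e _
  rw [hv, mul_zero]
  have := dbSize_le_update D i e
  omega

end Transition

/-! ### Isometries, projectors and the bound for algorithms. -/

section Operators

open Finset

variable {r c d : ℕ}

/-- The operator on the joint space that belongs to a matrix. -/
noncomputable abbrev jointOp (M : Matrix (JointBasis r c d) (JointBasis r c d) ℂ) :
    EuclideanSpace ℂ (JointBasis r c d) →L[ℂ] EuclideanSpace ℂ (JointBasis r c d) :=
  Matrix.toEuclideanCLM (𝕜 := ℂ) M

theorem jointOp_mul (M N : Matrix (JointBasis r c d) (JointBasis r c d) ℂ)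
    (v : EuclideanSpace ℂ (JointBasis r c d)) : jointOp (M * N) v = jointOp M (jointOp N v) := by
  rw [jointOp, map_mul]
  rfl

theorem jointOp_apply (M : Matrix (JointBasis r c d) (JointBasis r c d) ℂ)
    (v : EuclideanSpace ℂ (JointBasis r c d)) (s : JointBasis r c d) :
    jointOp M v s = M.mulVec v.ofLp s := rfl

theorem norm_jointOp_of_conjTranspose_mul_self
    {M : Matrix (JointBasis r c d) (JointBasis r c d) ℂ} (hM : M.conjTranspose * M = 1)
    (v : EuclideanSpace ℂ (JointBasis r c d)) : ‖jointOp M v‖ = ‖v‖ := by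
  have h : ContinuousLinearMap.adjoint (jointOp M) * jointOp M = 1 := by
    rw [← ContinuousLinearMap.star_eq_adjoint, jointOp, ← map_star, ← map_mul,
      Matrix.star_eq_conjTranspose, hM, map_one]
  have h2 : ‖jointOp M v‖ ^ 2 = ‖v‖ ^ 2 := by
    rw [ContinuousLinearMap.apply_norm_sq_eq_inner_adjoint_left, ← ContinuousLinearMap.mul_def, h,
      one_apply_eq_self, inner_self_eq_norm_sq]
  exact (sq_eq_sq₀ (norm_nonneg _) (norm_nonneg _)).1 h2

theorem onAlg_conjTranspose_mul_self (U : Matrix.unitaryGroup (AlgBasis r c d) ℂ) :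
    (onAlg U.1 : Matrix (JointBasis r c d) (JointBasis r c d) ℂ).conjTranspose * onAlg U.1 = 1 := by
  have hU : U.1.conjTranspose * U.1 = 1 := Matrix.UnitaryGroup.star_mul_self U
  rw [onAlg, Matrix.conjTranspose_kronecker, ← Matrix.mul_kronecker_mul, hU,
    Matrix.conjTranspose_one, mul_one, Matrix.one_kronecker_one]

theorem onDatabase_compression_mul_self :
    onDatabase d (compression r c) * onDatabase d (compression r c) = 1 := by
  rw [onDatabase, ← Matrix.mul_kronecker_mul, compression_mul_self, mul_one,
    Matrix.one_kronecker_one]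

theorem purifiedStep_injective : Function.Injective (purifiedStep (r := r) (c := c) (d := d)) := by
  rintro ⟨⟨⟨i, y⟩, w⟩, D⟩ ⟨⟨⟨i', y'⟩, w'⟩, D'⟩ h
  simp only [purifiedStep, Prod.mk.injEq, Sigma.mk.injEq] at h
  obtain ⟨⟨⟨rfl, h⟩, rfl⟩, rfl⟩ := h
  rw [add_right_cancel (eq_of_heq h)]

theorem purifiedOracle_conjTranspose_mul_self :
    (purifiedOracle r c d).conjTranspose * purifiedOracle r c d = 1 := by
  ext s s'
  rw [Matrix.mul_apply, Fintype.sum_eq_single (purifiedStep s')]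
  · simp [purifiedOracle, Matrix.one_apply, purifiedStep_injective.eq_iff, eq_comm]
  · intro t ht
    simp [purifiedOracle, ht]

theorem compressedOracle_conjTranspose_mul_self :
    (compressedOracle r c d).conjTranspose * compressedOracle r c d = 1 := by
  simp only [compressedOracle, Matrix.conjTranspose_mul, onDatabase_compression_conjTranspose]
  set C := onDatabase d (compression r c)
  set P := purifiedOracle r c d
  calc C * (P.conjTranspose * C) * (C * P * C)
      = C * (P.conjTranspose * ((C * C) * P)) * C := by simp only [mul_assoc]
    _ = 1 := by
      rw [onDatabase_compression_mul_self, one_mul, purifiedOracle_conjTranspose_mul_self, mul_one,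
        onDatabase_compression_mul_self]

theorem norm_jointOp_onAlg (U : Matrix.unitaryGroup (AlgBasis r c d) ℂ)
    (v : EuclideanSpace ℂ (JointBasis r c d)) : ‖jointOp (onAlg U.1) v‖ = ‖v‖ :=
  norm_jointOp_of_conjTranspose_mul_self (onAlg_conjTranspose_mul_self U) v

theorem norm_jointOp_compressedOracle (v : EuclideanSpace ℂ (JointBasis r c d)) :
    ‖jointOp (compressedOracle r c d) v‖ = ‖v‖ :=
  norm_jointOp_of_conjTranspose_mul_self compressedOracle_conjTranspose_mul_self v

theorem onAlg_mul_databaseProjector (U : Matrix (AlgBasis r c d) (AlgBasis r c d) ℂ)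
    (P : Set (Database r c)) :
    onAlg U * databaseProjector d P = databaseProjector d P * onAlg U := by
  rw [onAlg, databaseProjector, onDatabase, ← Matrix.mul_kronecker_mul, ← Matrix.mul_kronecker_mul,
    mul_one, mul_one, one_mul, one_mul]

open Classical in
theorem jointOp_databaseProjector_apply (P : Set (Database r c))
    (v : EuclideanSpace ℂ (JointBasis r c d)) (s : JointBasis r c d) :
    jointOp (databaseProjector d P) v s = if s.2 ∈ P then v s else 0 := by
  obtain ⟨a, D⟩ := s
  rw [jointOp_apply, databaseProjector, onDatabase_mulVec, Fintype.sum_eq_single D]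
  · simp
  · intro D' hD'
    simp [Matrix.diagonal_apply_ne _ hD'.symm]

open Classical in
theorem norm_sq_jointOp_databaseProjector (P : Set (Database r c))
    (v : EuclideanSpace ℂ (JointBasis r c d)) :
    ‖jointOp (databaseProjector d P) v‖ ^ 2 = ∑ s, if s.2 ∈ P then ‖v s‖ ^ 2 else 0 := by
  rw [EuclideanSpace.norm_sq_eq]
  refine sum_congr rfl fun s _ => ?_
  rw [jointOp_databaseProjector_apply]
  split_ifs <;> simp

theorem norm_jointOp_databaseProjector_le (P : Set (Database r c))
    (v : EuclideanSpace ℂ (JointBasis r c d)) : ‖jointOp (databaseProjector d P) v‖ ≤ ‖v‖ := by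
  classical
  refine (sq_le_sq₀ (norm_nonneg _) (norm_nonneg _)).1 ?_
  rw [norm_sq_jointOp_databaseProjector, EuclideanSpace.norm_sq_eq]
  refine sum_le_sum fun s _ => ?_
  split_ifs
  · exact le_rfl
  · positivity

/-- Treating the missing unitary before the first query as the identity unifies the base cases for
induction. -/
theorem queryChain_succ (U : ℕ → Matrix.unitaryGroup (AlgBasis r c d) ℂ) (t : ℕ) :
    queryChain U (t + 1) = compressedOracle r c d *
      onAlg (if t = 0 then 1 else U t : Matrix.unitaryGroup (AlgBasis r c d) ℂ).1 *
        queryChain U t := by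
  cases t with
  | zero => simp [queryChain, onAlg]
  | succ t => simp [queryChain]

theorem norm_jointOp_queryChain (U : ℕ → Matrix.unitaryGroup (AlgBasis r c d) ℂ) (t : ℕ)
    (v : EuclideanSpace ℂ (JointBasis r c d)) : ‖jointOp (queryChain U t) v‖ = ‖v‖ := by
  induction t with
  | zero => simp [queryChain, jointOp]
  | succ t ih =>
    rw [queryChain_succ, jointOp_mul, jointOp_mul, norm_jointOp_compressedOracle,
      norm_jointOp_onAlg, ih]

/-- The chain is an isometry between two contractions. Boundedness is essential: the real `sSup` of
an unbounded set is `0`, and no individual norm could be compared with it. -/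
theorem bddAbove_transitionCapacity (q : ℕ) (P Q : Set (Database r c)) :
    BddAbove {a : ℝ | ∃ d : ℕ, 0 < d ∧ ∃ U : ℕ → Matrix.unitaryGroup (AlgBasis r c d) ℂ,
      a = ‖Matrix.toEuclideanCLM (𝕜 := ℂ)
        (databaseProjector d Q * queryChain U q * databaseProjector d P)‖} := by
  refine ⟨1, ?_⟩
  rintro a ⟨d, -, U, rfl⟩
  refine ContinuousLinearMap.opNorm_le_bound _ zero_le_one fun v => ?_
  rw [one_mul]
  change ‖jointOp _ v‖ ≤ _
  rw [jointOp_mul, jointOp_mul]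
  refine (norm_jointOp_databaseProjector_le _ _).trans ?_
  rw [norm_jointOp_queryChain]
  exact norm_jointOp_databaseProjector_le _ _

/-- The initial joint state of an algorithm. -/
noncomputable def QueryAlgorithm.initState (A : QueryAlgorithm r c) :
    EuclideanSpace ℂ (JointBasis r c A.dim) :=
  WithLp.toLp 2 fun s => if s.2 = emptyDatabase r c then A.init s.1 else 0

theorem QueryAlgorithm.norm_initState (A : QueryAlgorithm r c) : ‖A.initState‖ = 1 := by
  rw [← A.norm_init, EuclideanSpace.norm_eq, EuclideanSpace.norm_eq, Fintype.sum_prod_type]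
  congr 1
  refine sum_congr rfl fun a _ => ?_
  rw [Fintype.sum_eq_single (emptyDatabase r c)]
  · simp [initState]
  · intro D hD
    simp [initState, hD]

theorem QueryAlgorithm.state_eq (A : QueryAlgorithm r c) (q : ℕ) :
    A.state q = jointOp (onAlg (if q = 0 then 1 else A.U q :
      Matrix.unitaryGroup (AlgBasis r c A.dim) ℂ).1)
        (jointOp (queryChain A.U q) (jointOp (onAlg (A.U 0).1) A.initState)) := by
  induction q with
  | zero =>
    have h1 : (onAlg (1 : Matrix (AlgBasis r c A.dim) (AlgBasis r c A.dim) ℂ)) = 1 := by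
      simp [onAlg]
    simp only [if_true, Matrix.UnitaryGroup.one_val, h1, queryChain, jointOp, map_one,
      one_apply_eq_self]
    rfl
  | succ q ih =>
    rw [QueryAlgorithm.state, ih, queryChain_succ, if_neg (Nat.succ_ne_zero q)]
    simp only [jointOp_mul]

/-- The unitaries before the first and after the last query act only on the algorithm, so they pass
through the projectors and preserve norms. What remains is one operator in the supremum, applied to
a unit vector. -/
theorem QueryAlgorithm.prob_le_transitionCapacity_sq (A : QueryAlgorithm r c) (q : ℕ)
    (Q : Set (Database r c)) :
    A.prob q Q ≤ transitionCapacity q {emptyDatabase r c} Q ^ 2 := by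
  -- A zero-dimensional workspace would leave no unit initial state.
  have hdim : 0 < A.dim := by
    rcases Nat.eq_zero_or_pos A.dim with h0 | h0
    · have : IsEmpty (AlgBasis r c A.dim) := by
        rw [h0]
        infer_instance
      have h1 := A.norm_init
      rw [Subsingleton.elim A.init 0, norm_zero] at h1
      exact absurd h1 zero_ne_one
    · exact h0
  have hinit : jointOp (databaseProjector A.dim {emptyDatabase r c}) A.initState =
      A.initState := by
    ext s
    rw [jointOp_databaseProjector_apply]
    by_cases h : s.2 = emptyDatabase r c <;> simp [initState, h]
  refine pow_le_pow_left₀ (norm_nonneg _) ?_ 2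
  refine le_trans ?_ (le_csSup (bddAbove_transitionCapacity q _ Q) ⟨A.dim, hdim, A.U, rfl⟩)
  have h : Matrix.toEuclideanCLM (𝕜 := ℂ) (databaseProjector A.dim Q) (A.state q) =
      jointOp (onAlg (if q = 0 then 1 else A.U q :
        Matrix.unitaryGroup (AlgBasis r c A.dim) ℂ).1)
        (jointOp (databaseProjector A.dim Q * queryChain A.U q *
          databaseProjector A.dim {emptyDatabase r c})
          (jointOp (onAlg (A.U 0).1) A.initState)) := by
    rw [A.state_eq]
    conv_lhs => rw [← hinit]
    rw [← jointOp_mul (onAlg (A.U 0).1), onAlg_mul_databaseProjector, ← jointOp_mul _ (onAlg _),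
      ← jointOp_mul _ (onAlg _)]
    simp only [← jointOp_mul, ← mul_assoc]
    rw [onAlg_mul_databaseProjector]
  rw [h, norm_jointOp_onAlg]
  refine (ContinuousLinearMap.le_opNorm _ _).trans (le_of_eq ?_)
  rw [norm_jointOp_onAlg, A.norm_initState, mul_one]

end Operators

/-! ### Accumulating amplitude over the queries. -/

section Capacity

open Finset

variable {r c d : ℕ}

open Classical in
/-- The weight on `Q` grows by `O(√γ)` with each query, if `γ` bounds the fraction of the values
of a new entry that lead into `Q` from a database outside of `Q` with fewer than `q` entries. -/
theorem transitionCapacity_le {Q : Set (Database r c)} {γ : ℝ} (hγ : 0 ≤ γ) {q : ℕ}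
    (hempty : emptyDatabase r c ∉ Q)
    (hmono : ∀ (D : Database r c) i e, D i = none → D ∈ Q → Function.update D i e ∈ Q)
    (hQ : ∀ (D : Database r c) i, D i = none → D ∉ Q → dbSize D < q →
      (#{y | Function.update D i (some y) ∈ Q} : ℝ) ≤ γ * 2 ^ outLen i) :
    transitionCapacity q {emptyDatabase r c} Q ≤ q * (6 * √γ) := by
  refine Real.sSup_le ?_ (by positivity)
  rintro a ⟨d, -, U, rfl⟩
  refine ContinuousLinearMap.opNorm_le_bound _ (by positivity) fun u => ?_
  change ‖jointOp _ u‖ ≤ _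
  rw [jointOp_mul, jointOp_mul]
  set u₀ := jointOp (databaseProjector d {emptyDatabase r c}) u with hu₀
  have hu₀le : ‖u₀‖ ≤ ‖u‖ := norm_jointOp_databaseProjector_le _ _
  -- The part of `v` in `Q` contributes at most its norm. The part outside, supported on databases
  -- with fewer than `q` entries, contributes at most `6 * √γ` times its norm.
  have hstep : ∀ v : EuclideanSpace ℂ (JointBasis r c d),
      (∀ a D, q ≤ dbSize D → v (a, D) = 0) →
      ‖jointOp (databaseProjector d Q) (jointOp (compressedOracle r c d) v)‖ ≤
        ‖jointOp (databaseProjector d Q) v‖ + 6 * √γ * ‖v‖ := by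
    intro v hv
    set v₁ := jointOp (databaseProjector d Q) v
    set v₂ := jointOp (databaseProjector d Qᶜ) v
    have hsplit : v = v₁ + v₂ := by
      ext s
      rw [PiLp.add_apply, jointOp_databaseProjector_apply, jointOp_databaseProjector_apply]
      by_cases hs : s.2 ∈ Q <;> simp [hs]
    have hv₂ : ‖v₂‖ ≤ ‖v‖ := norm_jointOp_databaseProjector_le _ _
    have h2 : ‖jointOp (databaseProjector d Q) (jointOp (compressedOracle r c d) v₂)‖ ≤
        6 * √γ * ‖v₂‖ := by
      refine (sq_le_sq₀ (norm_nonneg _) (by positivity)).1 ?_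
      rw [norm_sq_jointOp_databaseProjector, mul_pow, mul_pow, Real.sq_sqrt hγ,
        EuclideanSpace.norm_sq_eq]
      have := sum_norm_sq_compressedOracle_le (d := d) (γ := γ) (Q := Q)
        (P := {D | D ∉ Q ∧ dbSize D < q})
        (Set.disjoint_left.2 fun D hD => hD.1) ?_ v₂.ofLp ?_
      · norm_num
        exact this
      · intro i D hD
        -- If the fibre's empty-entry database lies in `Q`, monotonicity puts the entire fibre in
        -- `Q`, so it carries no amplitude from outside.
        by_cases hDQ : D ∈ Q
        · exact .inl fun e he => he.1 (hmono D i e hD hDQ)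
        by_cases hDq : dbSize D < q
        · exact .inr ⟨hDQ, hQ D i hD hDQ hDq⟩
        · exact .inl fun e he => hDq ((dbSize_update_none_le D i hD e).trans_lt he.2)
      · intro a D hD
        rw [jointOp_databaseProjector_apply]
        split_ifs with hs
        · exact hv a D (not_lt.1 fun hlt => hD ⟨hs, hlt⟩)
        · rfl
    conv_lhs => rw [hsplit, map_add, map_add]
    refine (norm_add_le _ _).trans (add_le_add ?_ (h2.trans ?_))
    · exact (norm_jointOp_databaseProjector_le _ _).trans (norm_jointOp_compressedOracle _).le
    · gcongr
  -- The support bound is carried along: after `t` queries there are at most `t` entries, so every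
  -- query starts with fewer than `q`, as `hstep` requires.
  have hind : ∀ t ≤ q, (∀ a D, t < dbSize D → jointOp (queryChain U t) u₀ (a, D) = 0) ∧
      ‖jointOp (databaseProjector d Q) (jointOp (queryChain U t) u₀)‖ ≤ t * (6 * √γ) * ‖u‖ := by
    intro t
    induction t with
    | zero =>
      intro _
      have h1 : jointOp (queryChain U 0) u₀ = u₀ := by simp [queryChain, jointOp]
      rw [h1]
      constructor
      · intro a D hD
        rw [hu₀, jointOp_databaseProjector_apply, if_neg]
        rintro rfl
        simp [dbSize, emptyDatabase] at hD
      · have : jointOp (databaseProjector d Q) u₀ = 0 := by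
          ext s
          rw [jointOp_databaseProjector_apply, hu₀, jointOp_databaseProjector_apply]
          split_ifs with h1 h2
          · exact absurd ((show s.2 = emptyDatabase r c from h2) ▸ h1) hempty
          · rfl
          · rfl
        simp [this]
    | succ t ih =>
      intro ht
      obtain ⟨ih1, ih2⟩ := ih (by omega)
      set W : Matrix.unitaryGroup (AlgBasis r c d) ℂ := if t = 0 then 1 else U t with hW
      set v := jointOp (onAlg W.1) (jointOp (queryChain U t) u₀) with hv
      have hvs : ∀ a D, t < dbSize D → v (a, D) = 0 := by
        intro a D hD
        rw [hv, jointOp_apply, onAlg_mulVec]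
        exact sum_eq_zero fun a' _ => by rw [ih1 a' D hD, mul_zero]
      have hsucc : jointOp (queryChain U (t + 1)) u₀ = jointOp (compressedOracle r c d) v := by
        rw [queryChain_succ, jointOp_mul, jointOp_mul]
      rw [hsucc]
      refine ⟨fun a D hD => compressedOracle_mulVec_eq_zero _ hvs a D hD, ?_⟩
      refine (hstep v fun a D hD => hvs a D (by omega)).trans ?_
      have h1 : ‖jointOp (databaseProjector d Q) v‖ ≤ t * (6 * √γ) * ‖u‖ := by
        rw [hv, ← jointOp_mul, ← onAlg_mul_databaseProjector, jointOp_mul, norm_jointOp_onAlg]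
        exact ih2
      have h2 : ‖v‖ ≤ ‖u‖ := by
        rw [hv, norm_jointOp_onAlg, norm_jointOp_queryChain]
        exact hu₀le
      calc _ ≤ t * (6 * √γ) * ‖u‖ + 6 * √γ * ‖u‖ := by gcongr
        _ = _ := by push_cast; ring
  exact (hind q le_rfl).2

theorem transitionCapacity_nonneg (q : ℕ) (P Q : Set (Database r c)) :
    0 ≤ transitionCapacity q P Q :=
  Real.sSup_nonneg (by
    rintro a ⟨d, -, U, rfl⟩
    exact norm_nonneg _)

theorem transitionCapacity_BAD_sq_le {π : Equiv.Perm (Bits r × Bits c)} {M : ℕ} (hM : 0 < M)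
    (hπ : IsSpread M π) (q : ℕ) :
    transitionCapacity q {emptyDatabase r c} (BAD π) ^ 2 ≤ 108 * (q : ℝ) ^ 5 * (M / 2 ^ c) := by
  classical
  set γ : ℝ := 3 * (q : ℝ) ^ 3 * M / 2 ^ c with hγ
  have hγ0 : 0 ≤ γ := by positivity
  have h := transitionCapacity_le (r := r) (c := c) (Q := BAD π) hγ0 (q := q)
    emptyDatabase_not_mem_BAD ?_ ?_
  · calc _ ≤ ((q : ℝ) * (6 * √γ)) ^ 2 := pow_le_pow_left₀ (transitionCapacity_nonneg _ _ _) h 2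
      _ = q ^ 2 * 36 * √γ ^ 2 := by ring
      _ = _ := by rw [Real.sq_sqrt hγ0, hγ]; ring
  · intro D i e hi hD
    apply mem_BAD_of_update_none
    rwa [← hi, Function.update_eq_self]
  · intro D i _ hD hq
    have key := card_update_mem_BAD_le hM hπ hD hq i
    rw [hγ, div_mul_eq_mul_div, le_div_iff₀ (by positivity)]
    exact_mod_cast key

end Capacity

/-! ### Choice of constants and conclusion. -/

theorem mainTheorem5 :
    ∃ C : ℝ, 0 < C ∧ ∀ r c : ℕ, 0 < r → 0 < c →
      (∀ (π : Equiv.Perm (Bits r × Bits c)) (q : ℕ) (A : QueryAlgorithm r c),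
        A.prob q (BAD π) ≤ transitionCapacity q {emptyDatabase r c} (BAD π) ^ 2) ∧
      ∃ G : Set (Equiv.Perm (Bits r × Bits c)),
        (1 - 1 / 2 ^ (r + c) : ℝ) * Nat.card (Equiv.Perm (Bits r × Bits c)) ≤ Nat.card G ∧
        ∀ π ∈ G, ∀ q : ℕ,
          transitionCapacity q {emptyDatabase r c} (BAD π) ^ 2 ≤
            C * (q : ℝ) ^ 5 * ((r + c : ℕ) : ℝ) / 2 ^ min r c := by
  classical
  -- `2592 = 108 * 24`: the spread constant is `2 * t`, and `2 * t / 2 ^ c = 24 * (r + c) / 2 ^ min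
  -- r c`.
  refine ⟨2592, by norm_num, fun r c hr hc =>
    ⟨fun π q A => A.prob_le_transitionCapacity_sq q (BAD π), ?_⟩⟩
  -- Large enough for the tail bound (`12 * 2 ^ c ≤ t * 2 ^ r`) and the union bound (`5 * (r + c) ≤
  -- t`), and larger than `2 ^ c` when `r = 1`.
  set t : ℕ := 12 * (r + c) * 2 ^ (c - min r c) with ht
  have hpow : 2 ^ (c - min r c) * 2 ^ min r c = 2 ^ c := by
    rw [← pow_add, Nat.sub_add_cancel (min_le_right r c)]
  have h1 : 12 * 2 ^ c ≤ t * 2 ^ r := by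
    calc 12 * 2 ^ c = 12 * 1 * (2 ^ (c - min r c) * 2 ^ min r c) := by rw [hpow]
      _ ≤ 12 * (r + c) * (2 ^ (c - min r c) * 2 ^ r) := by
          gcongr
          · omega
          · norm_num
          · exact min_le_left r c
      _ = t * 2 ^ r := by rw [ht]; ring
  have h2 : 5 * (r + c) ≤ t := by
    have : 1 ≤ 2 ^ (c - min r c) := Nat.one_le_two_pow
    calc 5 * (r + c) ≤ 12 * (r + c) * 1 := by omega
      _ ≤ t := Nat.mul_le_mul_left _ this
  have h3 : r = 1 → 2 ^ c < t := by
    rintro rfl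
    have hmin : min 1 c = 1 := min_eq_left hc
    rw [hmin] at hpow ht
    have : 12 * (1 + c) * 2 ^ (c - 1) = 2 ^ (c - 1) * 2 ^ 1 + (12 * c + 10) * 2 ^ (c - 1) := by
      ring
    rw [ht, this, hpow]
    exact Nat.lt_add_of_pos_right (by positivity)
  refine ⟨{π | IsSpread (2 * t) π}, ?_, fun π hπ q => ?_⟩
  · have hbad := card_not_isSpread_le hr h1 h2 h3
    have hsum := Finset.card_filter_add_card_filter_not
      (s := (Finset.univ : Finset (Equiv.Perm (Bits r × Bits c)))) (fun π => IsSpread (2 * t) π)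
    rw [Finset.card_univ] at hsum
    have hG : Nat.card {π : Equiv.Perm (Bits r × Bits c) | IsSpread (2 * t) π} =
        (Finset.univ.filter fun π : Equiv.Perm (Bits r × Bits c) => IsSpread (2 * t) π).card := by
      rw [Nat.card_eq_fintype_card]
      exact Fintype.card_subtype _
    rw [hG, Nat.card_eq_fintype_card]
    have hsum' := congrArg (Nat.cast (R := ℝ)) hsum
    rw [Nat.cast_add] at hsum'
    rw [sub_mul, one_mul]
    linarith
  · have ht0 : 0 < 2 * t := by omega
    refine (transitionCapacity_BAD_sq_le ht0 hπ q).trans (le_of_eq ?_)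
    have hpow' : (2 : ℝ) ^ (c - min r c) * 2 ^ min r c = 2 ^ c := by exact_mod_cast hpow
    rw [← hpow', ht]
    push_cast
    field_simp
    ring
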